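/- Let $Y=\{Y(t,s);(t,s)\in\mathbb Z^2\}$ be a stationary zero-mean real Gaussian random field with spectral density $$f(x,y)=\frac{g(x,y)}{|x|^{2d_1}|y|^{2d_2}},\qquad (x,y)\in[-\pi,\pi]^2,$$ that is, $\mathrm{Cov}(Y(t,s),Y(t',s'))=\int_{[-\pi,\pi]^2}e^{i((t-t')x+(s-s')y)}f(x,y)\,dx\,dy$, where $0<d_1,d_2<1/2$ and $g\ge 0$ is a bounded function with $g(x,y)\to 1$ as $(x,y)\to(0,0)$. For $0<d<1/2$ let $\kappa(d)>0$ be given by the convergent integral $$\kappa^2(d):=\int_{\mathbb R}|1-e^{ix}|^2|x|^{-2-2d}\,dx=\frac{\pi}{(d+\frac12)\,\Gamma(2d+1)\cos(\pi d)}.$$ Let $B=B_{d_1+1/2,\,d_2+1/2}$ be a fractional Brownian sheet (which exists), where $B_{H_1,H_2}$ denotes a zero-mean Gaussian field on $[0,\infty)^2$ with $$\mathrm E\,B_{H_1,H_2}(x,y)B_{H_1,H_2}(x',y')=\tfrac14\big(x^{2H_1}+x'^{2H_1}-|x-x'|^{2H_1}\big)\big(y^{2H_2}+y'^{2H_2}-|y-y'|^{2H_2}\big).$$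 Then for every $\gamma>0$, with $H(\gamma):=\frac{1+\gamma}{2}+d_1+d_2\gamma$, $$n^{-H(\gamma)}\sum_{1\le t\le nx,\;1\le s\le n^\gamma y}Y(t,s)\;\longrightarrow\;\kappa(d_1)\kappa(d_2)\,B(x,y),\qquad x,y>0,\quad n\to\infty,$$ in the sense of weak convergence of finite-dimensional distributions. In particular this holds for $\gamma=1$, with $H(1)=1+d_1+d_2$. Consequently $Y$ has Type II distributional long-range dependence, that is: $Y$ is stationary, and for every $\gamma>0$ there are an exponent $H(\gamma)>0$ and a random field $V_\gamma$ on $[0,\infty)^2$, almost surely zero at each point of the coordinate axes and with stationary rectangular increments, such that $n^{-H(\gamma)}\sum_{1\le t\le nx,\,1\le s\le n^\gamma y}Y(t,s)\to V_\gamma(x,y)$, $x,y>0$, in finite-dimensional distributions, and $V_\gamma$ has dependent rectangular increments in every direction. Here the increment of $V$ on a rectangle $K=(u,x]\times(v,y]$, $0\le u<x$, $0\le v<y$, is $V(K)=V(x,y)-V(u,y)-V(x,v)+V(u,v)$. Rectangular increments are stationary if for all $u,v>0$ the fields $V((u,u+h]\times(v,v+k])$ and $V((0,h]\times(0,k])$,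 indexed by $h,k\ge0$, have the same finite-dimensional distributions. For a line $\ell$ through the origin, the increments are independent in direction $\ell$ if $V(K),V(K')$ are independent for any two rectangles $K,K'$ lying on different sides of some line $\ell'$ orthogonal to $\ell$ (points on $\ell'$ count as belonging to both sides); they are invariant in direction $\ell$ if $V(K)=V(K')$ almost surely whenever $K'=K+p$ with $p\in\ell$; and they are dependent in direction $\ell$ if they are neither independent nor invariant in direction $\ell$. -/

import Mathlib

open MeasureTheory ProbabilityTheory Filter Topology
open scoped NNReal

noncomputable section

namespace LRD

/-! ### Random fields on `ℤ²`: stationarity, spectral density, partial sums -/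

/-- A random field on `ℤ²` is (strictly) stationary: its finite-dimensional distributions are
invariant under all shifts of `ℤ²`. -/
def IsStationaryField {Ω : Type*} [MeasurableSpace Ω] (Y : ℤ × ℤ → Ω → ℝ) (P : Measure Ω) : Prop :=
  ∀ (h : ℤ × ℤ) (I : Finset (ℤ × ℤ)),
    IdentDistrib (fun ω (t : I) => Y (t.1 + h) ω) (fun ω (t : I) => Y t.1 ω) P P

/-- The frequency domain `Π² = [-π, π]²`. -/
def freqSquare : Set (ℝ × ℝ) := Set.Icc (-Real.pi) Real.pi ×ˢ Set.Icc (-Real.pi) Real.pi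

/-- `f` is a spectral density of the random field `Y` on `ℤ²`: it is nonnegative and integrable
on `Π²`, and `Cov(Y(t), Y(s)) = ∫_{Π²} exp(i ⟨t - s, z⟩) f(z) dz` for all `t, s ∈ ℤ²`. -/
structure IsSpectralDensity {Ω : Type*} [MeasurableSpace Ω] (Y : ℤ × ℤ → Ω → ℝ) (P : Measure Ω)
    (f : ℝ × ℝ → ℝ) : Prop where
  nonneg : ∀ᵐ z ∂(volume.restrict freqSquare), 0 ≤ f z
  integrable : IntegrableOn f freqSquare
  cov_eq : ∀ t s : ℤ × ℤ,
    ((cov[Y t, Y s; P] : ℝ) : ℂ) =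
      ∫ z in freqSquare,
        Complex.exp (Complex.I *
          (((t.1 - s.1 : ℤ) : ℂ) * (z.1 : ℂ) + ((t.2 - s.2 : ℤ) : ℂ) * (z.2 : ℂ))) * (f z : ℂ)

/-- The partial sum of `Y` over
`K_{[nx, n^γ y]} = {(t, s) ∈ ℤ² : 1 ≤ t ≤ n x, 1 ≤ s ≤ n^γ y}`. -/
def partialSum {Ω : Type*} (Y : ℤ × ℤ → Ω → ℝ) (γ : ℝ) (n : ℕ) (x y : ℝ) (ω : Ω) : ℝ :=
  ∑ t ∈ Finset.Icc (1 : ℤ) ⌊(n : ℝ) * x⌋ ×ˢ Finset.Icc (1 : ℤ) ⌊(n : ℝ) ^ γ * y⌋, Y t ω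

/-- `n^{-H} ∑_{(t,s) ∈ K_{[nx, n^γ y]}} Y(t,s)` converges to `V(x,y)`, `x, y > 0`, as `n → ∞`, in
the sense of weak convergence of finite-dimensional distributions. -/
def ScalingLimit {Ω Ω' : Type*} [MeasurableSpace Ω] [MeasurableSpace Ω']
    (Y : ℤ × ℤ → Ω → ℝ) (P : Measure Ω) [IsProbabilityMeasure P] (γ H : ℝ)
    (V : ℝ≥0 × ℝ≥0 → Ω' → ℝ) (P' : Measure Ω') [IsProbabilityMeasure P'] : Prop :=
  ∀ I : Finset (ℝ≥0 × ℝ≥0), (∀ p ∈ I, 0 < p.1 ∧ 0 < p.2) →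
    TendstoInDistribution
      (fun (n : ℕ) ω (p : I) => (n : ℝ) ^ (-H) * partialSum Y γ n (p.1.1 : ℝ) (p.1.2 : ℝ) ω)
      atTop (fun ω' (p : I) => V p.1 ω') (fun _ => P) P'

/-! ### Rectangular increments of random fields on the closed quadrant -/

/-- The increment of `V` on the rectangle `(u, x] × (v, y]`. -/
def rectIncr {Ω : Type*} (V : ℝ≥0 × ℝ≥0 → Ω → ℝ) (u v x y : ℝ≥0) (ω : Ω) : ℝ :=
  V (x, y) ω - V (u, y) ω - V (x, v) ω + V (u, v) ω

/-- A rectangle `(u, x] × (v, y]` in the open quadrant (`0 ≤ u < x`, `0 ≤ v < y`). -/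
structure Rect where
  u : ℝ≥0
  v : ℝ≥0
  x : ℝ≥0
  y : ℝ≥0
  u_lt_x : u < x
  v_lt_y : v < y

/-- The rectangle as a subset of the plane. -/
def Rect.toSet (K : Rect) : Set (ℝ × ℝ) :=
  Set.Ioc (K.u : ℝ) (K.x : ℝ) ×ˢ Set.Ioc (K.v : ℝ) (K.y : ℝ)

/-- The increment `V(K)`. -/
def Rect.incr {Ω : Type*} (K : Rect) (V : ℝ≥0 × ℝ≥0 → Ω → ℝ) : Ω → ℝ :=
  rectIncr V K.u K.v K.x K.y

/-- `K` and `K'` are separated by the line `{a x + b y = c}`: they lie on different sides of it. -/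
def Rect.Separated (a b c : ℝ) (K K' : Rect) : Prop :=
  ((∀ p ∈ K.toSet, a * p.1 + b * p.2 ≤ c) ∧ (∀ p ∈ K'.toSet, c ≤ a * p.1 + b * p.2)) ∨
  ((∀ p ∈ K.toSet, c ≤ a * p.1 + b * p.2) ∧ (∀ p ∈ K'.toSet, a * p.1 + b * p.2 ≤ c))

/-- Stationary rectangular increments: for every `(u, v)` with `u, v > 0`, the fields
`V((u, u+h] × (v, v+k])` and `V((0, h] × (0, k])`, indexed by `h, k ≥ 0`, have the same
finite-dimensional distributions. -/
def HasStationaryRectIncr {Ω : Type*} [MeasurableSpace Ω]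
    (V : ℝ≥0 × ℝ≥0 → Ω → ℝ) (P : Measure Ω) : Prop :=
  ∀ u v : ℝ≥0, 0 < u → 0 < v → ∀ I : Finset (ℝ≥0 × ℝ≥0),
    IdentDistrib
      (fun ω (p : I) => rectIncr V u v (u + p.1.1) (v + p.1.2) ω)
      (fun ω (p : I) => rectIncr V 0 0 p.1.1 p.1.2 ω) P P

/-- Independent rectangular increments in the direction `ℓ = {a x + b y = 0}`: the increments on
two rectangles separated by a line `{a' x + b' y = c'}` orthogonal to `ℓ` are independent. -/
def HasIndepRectIncr {Ω : Type*} [MeasurableSpace Ω]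
    (V : ℝ≥0 × ℝ≥0 → Ω → ℝ) (P : Measure Ω) (a b : ℝ) : Prop :=
  ∀ a' b' c' : ℝ, (a', b') ≠ 0 → a * a' + b * b' = 0 →
    ∀ K K' : Rect, Rect.Separated a' b' c' K K' → IndepFun (K.incr V) (K'.incr V) P

/-- Invariant rectangular increments in the direction `ℓ = {a x + b y = 0}`: `V(K) = V(K')` almost
surely whenever `K'` is the translate of `K` by a vector of `ℓ`. -/
def HasInvariantRectIncr {Ω : Type*} [MeasurableSpace Ω]
    (V : ℝ≥0 × ℝ≥0 → Ω → ℝ) (P : Measure Ω) (a b : ℝ) : Prop :=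
  ∀ K K' : Rect, ∀ z w : ℝ, a * z + b * w = 0 →
    K'.toSet = (fun p : ℝ × ℝ => (z, w) + p) '' K.toSet → K.incr V =ᵐ[P] K'.incr V

/-- `V` is a random field on the closed quadrant with stationary rectangular increments, vanishing
on the axes, and in every direction `ℓ = {a x + b y = 0}` its rectangular increments are
dependent, that is neither independent nor invariant. -/
structure HasDependentRectIncr {Ω : Type*} [MeasurableSpace Ω]
    (V : ℝ≥0 × ℝ≥0 → Ω → ℝ) (P : Measure Ω) : Prop where
  aemeasurable : ∀ p, AEMeasurable (V p) P
  stationary : HasStationaryRectIncr V P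
  zero_right : ∀ x : ℝ≥0, V (x, 0) =ᵐ[P] 0
  zero_left : ∀ y : ℝ≥0, V (0, y) =ᵐ[P] 0
  dependent : ∀ a b : ℝ, (a, b) ≠ 0 →
    ¬ HasIndepRectIncr V P a b ∧ ¬ HasInvariantRectIncr V P a b

/-- Type II distributional long-range dependence: `Y` is stationary and for every `γ > 0` its
partial sums, with a normalization `n^{-H(γ)}`, `H(γ) > 0`, have a scaling limit `V_γ` with
dependent rectangular increments. (Only the law of `V_γ` matters, so a probability space in
`Type` is enough.) -/
def TypeIILRD {Ω : Type*} [MeasurableSpace Ω] (Y : ℤ × ℤ → Ω → ℝ) (P : Measure Ω)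
    [IsProbabilityMeasure P] : Prop :=
  IsStationaryField Y P ∧
  ∀ γ : ℝ, 0 < γ → ∃ H : ℝ, 0 < H ∧
    ∃ (Ω' : Type) (_ : MeasurableSpace Ω') (P' : Measure Ω') (_ : IsProbabilityMeasure P')
      (V : ℝ≥0 × ℝ≥0 → Ω' → ℝ), ScalingLimit Y P γ H V P' ∧ HasDependentRectIncr V P'

/-! ### The fractional Brownian sheet -/

/-- `B` is a fractional Brownian sheet with parameters `H₁, H₂`: a zero mean Gaussian process on
the closed quadrant with the covariance
`(1/4) (x^{2H₁} + x'^{2H₁} - |x - x'|^{2H₁}) (y^{2H₂} + y'^{2H₂} - |y - y'|^{2H₂})`. -/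
structure IsFractionalBrownianSheet {Ω : Type*} [MeasurableSpace Ω] (H₁ H₂ : ℝ)
    (B : ℝ≥0 × ℝ≥0 → Ω → ℝ) (P : Measure Ω) : Prop where
  gaussian : IsGaussianProcess B P
  mean_zero : ∀ p, ∫ ω, B p ω ∂P = 0
  cov_eq : ∀ p q : ℝ≥0 × ℝ≥0, cov[B p, B q; P] =
    (1 / 4 : ℝ) *
      ((p.1 : ℝ) ^ (2 * H₁) + (q.1 : ℝ) ^ (2 * H₁) - |(p.1 : ℝ) - (q.1 : ℝ)| ^ (2 * H₁)) *
      ((p.2 : ℝ) ^ (2 * H₂) + (q.2 : ℝ) ^ (2 * H₂) - |(p.2 : ℝ) - (q.2 : ℝ)| ^ (2 * H₂))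

/-- The integrand of `κ(d)²`. -/
def kappaIntegrand (d x : ℝ) : ℝ :=
  ‖1 - Complex.exp (Complex.I * (x : ℂ))‖ ^ 2 * |x| ^ (-2 - 2 * d)

/-- `κ(d) ≥ 0` with `κ(d)² = ∫_ℝ |1 - e^{ix}|² |x|^{-2-2d} dx`. -/
def kappa (d : ℝ) : ℝ := Real.sqrt (∫ x : ℝ, kappaIntegrand d x)

end LRD

end

/-! All variables involved are centred Gaussian, so convergence of finite-dimensional distributions
reduces to convergence of covariances (`tendstoInDistribution_of_tendsto_covariance`). By the
spectral representation, the covariance of two box sums is the integral of `f` against Dirichlet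
kernels in each coordinate (`covariance_sum_box`).

For boxes with sides proportional to `a = n` and `b = n^γ`, rescale the frequencies by `a` and `b`.
The Dirichlet kernels, divided by `a` and `b`, tend to Fourier transforms of indicators of
intervals; the weight `|x|^{-2d₁}|y|^{-2d₂}` is homogeneous in each variable, and `g` at the
rescaled frequency tends to 1. Jordan's inequality bounds the kernels uniformly by `min 1 |s|⁻¹`,
which gives dominated convergence (`tendsto_integral_expSum`). The limit factors, and each factor is
`κ(d)²` times the covariance of fractional Brownian motion with index `d + 1/2`
(`integral_indicatorFourier_mul_conj`). Nothing relates the two rates, so the limit is the same for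
every `γ`; only the normalization changes.

The sheet itself is an isonormal process evaluated at the spectral kernels. Its Hurst indices lie in
`(1/2, 1)` and its increment covariances are products of one-dimensional ones. Adjacent intervals of
equal length have increments with correlation strictly between 0 and 1: positivity excludes
independence in any direction, and being less than 1 excludes invariance. -/

namespace LRD

/-! ### Closed form of the constant `κ(d)²` -/

open Set in
/-- Tonelli's theorem for iterated Bochner integrals of a nonnegative function with integrable
sections. -/
theorem setIntegral_setIntegral_swap_of_nonneg {f : ℝ → ℝ → ℝ} {s : Set ℝ}
    (hs : MeasurableSet s) (hf : Measurable (Function.uncurry f))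
    (h0 : ∀ x ∈ s, ∀ y ∈ s, 0 ≤ f x y)
    (hx : ∀ x ∈ s, IntegrableOn (f x) s) (hy : ∀ y ∈ s, IntegrableOn (fun x => f x y) s) :
    ∫ x in s, ∫ y in s, f x y = ∫ y in s, ∫ x in s, f x y := by
  rw [integral_eq_lintegral_of_nonneg_ae, integral_eq_lintegral_of_nonneg_ae]
  · congr 1
    calc ∫⁻ x in s, ENNReal.ofReal (∫ y in s, f x y)
        = ∫⁻ x in s, ∫⁻ y in s, ENNReal.ofReal (f x y) := by
          refine setLIntegral_congr_fun hs fun x hxs => ?_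
          refine ofReal_integral_eq_lintegral_ofReal (hx x hxs) ?_
          exact (ae_restrict_iff' hs).2 (ae_of_all _ fun y hys => h0 x hxs y hys)
      _ = ∫⁻ y in s, ∫⁻ x in s, ENNReal.ofReal (f x y) :=
          lintegral_lintegral_swap hf.ennreal_ofReal.aemeasurable
      _ = _ := by
          refine setLIntegral_congr_fun hs fun y hys => ?_
          refine (ofReal_integral_eq_lintegral_ofReal (hy y hys) ?_).symm
          exact (ae_restrict_iff' hs).2 (ae_of_all _ fun x hxs => h0 x hxs y hys)
  · exact (ae_restrict_iff' hs).2 (ae_of_all _ fun y hys =>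
      setIntegral_nonneg hs fun x hxs => h0 x hxs y hys)
  · have h : StronglyMeasurable (Function.uncurry fun y x => f x y) :=
      (hf.comp measurable_swap).stronglyMeasurable
    exact h.integral_prod_right.aestronglyMeasurable
  · exact (ae_restrict_iff' hs).2 (ae_of_all _ fun x hxs =>
      setIntegral_nonneg hs fun y hys => h0 x hxs y hys)
  · exact hf.stronglyMeasurable.integral_prod_right.aestronglyMeasurable

-- An explicit antiderivative gives this Laplace transform. Since the integrand is nonnegative,
-- integrability follows from the existence of the limit of the antiderivative at infinity.
open Set in
theorem integral_one_sub_cos_mul_exp_neg {t : ℝ} (ht : 0 < t) :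
    IntegrableOn (fun x => (1 - Real.cos x) * Real.exp (-(x * t))) (Ioi 0) ∧
    ∫ x in Ioi (0 : ℝ), (1 - Real.cos x) * Real.exp (-(x * t)) = (t * (t ^ 2 + 1))⁻¹ := by
  set F : ℝ → ℝ := fun x =>
    -Real.exp (-(x * t)) * (t⁻¹ + (Real.sin x - t * Real.cos x) / (t ^ 2 + 1)) with hF
  have hd : ∀ x ∈ Ici (0 : ℝ), HasDerivAt F ((1 - Real.cos x) * Real.exp (-(x * t))) x := by
    intro x _
    have h1 : HasDerivAt (fun x => -Real.exp (-(x * t))) (t * Real.exp (-(x * t))) x := by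
      have := (((hasDerivAt_id x).mul_const t).neg.exp).neg
      exact this.congr_deriv (by simp; ring)
    have h2 : HasDerivAt (fun x => t⁻¹ + (Real.sin x - t * Real.cos x) / (t ^ 2 + 1))
        ((Real.cos x + t * Real.sin x) / (t ^ 2 + 1)) x := by
      have := (((Real.hasDerivAt_sin x).sub
        ((Real.hasDerivAt_cos x).const_mul t)).div_const (t ^ 2 + 1)).const_add t⁻¹
      exact this.congr_deriv (by ring)
    refine (h1.mul h2).congr_deriv ?_
    have : t ^ 2 + 1 ≠ 0 := by positivity
    field_simp
    ring
  have h0 : ∀ x ∈ Ioi (0 : ℝ), 0 ≤ (1 - Real.cos x) * Real.exp (-(x * t)) := fun x _ =>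
    mul_nonneg (sub_nonneg.2 (Real.cos_le_one x)) (Real.exp_pos _).le
  have hlim : Tendsto F atTop (𝓝 0) := by
    have he : Tendsto (fun x => -Real.exp (-(x * t))) atTop (𝓝 0) := by
      rw [← neg_zero]
      exact (Real.tendsto_exp_neg_atTop_nhds_zero.comp (tendsto_id.atTop_mul_const ht)).neg
    refine he.zero_mul_isBoundedUnder_le ?_
    refine isBoundedUnder_of ⟨t⁻¹ + (1 + t) / (t ^ 2 + 1), fun x => ?_⟩
    simp only [Function.comp, Real.norm_eq_abs]
    refine (abs_add_le _ _).trans ?_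
    rw [abs_of_pos (inv_pos.2 ht), abs_div, abs_of_pos (show 0 < t ^ 2 + 1 by positivity)]
    gcongr
    refine (abs_sub _ _).trans ?_
    rw [abs_mul, abs_of_pos ht]
    have := Real.abs_sin_le_one x
    have := Real.abs_cos_le_one x
    nlinarith
  refine ⟨integrableOn_Ioi_deriv_of_nonneg' hd h0 hlim, ?_⟩
  rw [integral_Ioi_of_hasDerivAt_of_nonneg' hd h0 hlim]
  simp only [hF, zero_mul, neg_zero, Real.exp_zero, Real.sin_zero, Real.cos_zero]
  have : t ^ 2 + 1 ≠ 0 := by positivity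
  field_simp
  ring

-- Writing `1/(t²+1)` as `∫ e^{-(t²+1)u} du` and swapping leaves a Gaussian moment in `t`, then a
-- Gamma integral in `u`; the product `Γ(1/2+d) Γ(1/2-d)` is evaluated by the reflection formula.
open Set in
theorem integral_rpow_div_one_add_sq {d : ℝ} (hd : -(1 / 2) < d) (hd' : d < 1 / 2) :
    ∫ t in Ioi (0 : ℝ), t ^ (2 * d) / (t ^ 2 + 1) = Real.pi / (2 * Real.cos (Real.pi * d)) := by
  have hu : ∀ t ∈ Ioi (0 : ℝ), ∀ c : ℝ,
      IntegrableOn (fun u => c * Real.exp (-(t ^ 2 + 1) * u)) (Ioi 0) := fun t _ c =>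
    (exp_neg_integrableOn_Ioi 0 (by positivity : (0 : ℝ) < t ^ 2 + 1)).const_mul c
  have htint : ∀ u ∈ Ioi (0 : ℝ),
      IntegrableOn (fun t => t ^ (2 * d) * Real.exp (-(t ^ 2 + 1) * u)) (Ioi 0) := by
    intro u hu
    have := (integrableOn_rpow_mul_exp_neg_mul_sq (b := u) hu
      (s := 2 * d) (by linarith)).const_mul (Real.exp (-u))
    refine this.congr (ae_of_all _ fun t => ?_)
    simp only
    rw [mul_left_comm, ← Real.exp_add]
    ring_nf
  have h := setIntegral_setIntegral_swap_of_nonneg (s := Ioi (0 : ℝ)) measurableSet_Ioi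
    (f := fun t u => t ^ (2 * d) * Real.exp (-(t ^ 2 + 1) * u)) (by fun_prop)
    (fun t ht u _ => mul_nonneg (Real.rpow_nonneg (le_of_lt ht) _) (Real.exp_pos _).le)
    (fun t ht => hu t ht _) htint
  have hL : ∫ t in Ioi (0 : ℝ), ∫ u in Ioi (0 : ℝ), t ^ (2 * d) * Real.exp (-(t ^ 2 + 1) * u)
      = ∫ t in Ioi (0 : ℝ), t ^ (2 * d) / (t ^ 2 + 1) := by
    refine setIntegral_congr_fun measurableSet_Ioi fun t _ => ?_
    have hp : 0 < t ^ 2 + 1 := by positivity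
    rw [integral_const_mul, integral_exp_mul_Ioi (by linarith : -(t ^ 2 + 1) < 0)]
    simp only [mul_zero, Real.exp_zero]
    field_simp
  have hR : ∫ u in Ioi (0 : ℝ), ∫ t in Ioi (0 : ℝ), t ^ (2 * d) * Real.exp (-(t ^ 2 + 1) * u)
      = ∫ u in Ioi (0 : ℝ), (1 / 2 * Real.Gamma (d + 1 / 2)) *
        (Real.exp (-u) * u ^ ((1 / 2 - d) - 1)) := by
    refine setIntegral_congr_fun measurableSet_Ioi fun u hu => ?_
    have : ∀ t : ℝ, t ^ (2 * d) * Real.exp (-(t ^ 2 + 1) * u) =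
        Real.exp (-u) * (t ^ (2 * d) * Real.exp (-u * t ^ (2 : ℝ))) := by
      intro t
      rw [mul_left_comm, ← Real.exp_add, Real.rpow_two]
      ring_nf
    simp_rw [this]
    rw [integral_const_mul, integral_rpow_mul_exp_neg_mul_rpow (by norm_num) (by linarith) hu]
    rw [show (2 * d + 1) / 2 = d + 1 / 2 by ring,
      show -(2 * d + 1) / 2 = (1 / 2 - d) - 1 by ring]
    ring
  rw [hL, hR, integral_const_mul, ← Real.Gamma_eq_integral (by linarith)] at h
  rw [h]
  have hr := Real.Gamma_mul_Gamma_one_sub (d + 1 / 2)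
  rw [show 1 - (d + 1 / 2) = 1 / 2 - d by ring,
    show Real.pi * (d + 1 / 2) = Real.pi * d + Real.pi / 2 by ring, Real.sin_add_pi_div_two] at hr
  rw [mul_assoc, hr]
  field_simp

-- Represent `Γ(2d+2) x^{-2-2d}` as `∫ t^{2d+1} e^{-xt} dt` and swap: the inner integral becomes the
-- Laplace transform of `1 - cos`, and what remains is `∫ t^{2d}/(t²+1) dt`.
open Set in
theorem integral_one_sub_cos_mul_rpow {d : ℝ} (hd : 0 < d) (hd' : d < 1 / 2) :
    ∫ x in Ioi (0 : ℝ), (1 - Real.cos x) * x ^ (-2 - 2 * d) =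
      Real.pi / (2 * Real.cos (Real.pi * d) * Real.Gamma (2 * d + 2)) := by
  have hG : 0 < Real.Gamma (2 * d + 2) := Real.Gamma_pos_of_pos (by linarith)
  have h := setIntegral_setIntegral_swap_of_nonneg (s := Ioi (0 : ℝ)) measurableSet_Ioi
    (f := fun x t => (1 - Real.cos x) * (t ^ (2 * d + 2 - 1) * Real.exp (-(x * t))))
    (by fun_prop)
    (fun x _ t ht => mul_nonneg (sub_nonneg.2 (Real.cos_le_one x))
      (mul_nonneg (Real.rpow_nonneg (le_of_lt ht) _) (Real.exp_pos _).le))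
    (fun x hx => by
      have := integrableOn_rpow_mul_exp_neg_mul_rpow (s := 2 * d + 2 - 1) (p := 1) (b := x)
        (by linarith) one_pos hx
      refine (this.const_mul (1 - Real.cos x)).congr (ae_of_all _ fun t => ?_)
      simp)
    (fun t ht => by
      refine ((integral_one_sub_cos_mul_exp_neg ht).1.const_mul (t ^ (2 * d + 2 - 1))).congr
        (ae_of_all _ fun x => ?_)
      simp only
      ring)
  have hL : ∫ x in Ioi (0 : ℝ), ∫ t in Ioi (0 : ℝ),
      (1 - Real.cos x) * (t ^ (2 * d + 2 - 1) * Real.exp (-(x * t))) =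
      Real.Gamma (2 * d + 2) * ∫ x in Ioi (0 : ℝ), (1 - Real.cos x) * x ^ (-2 - 2 * d) := by
    rw [← integral_const_mul]
    refine setIntegral_congr_fun measurableSet_Ioi fun x hx => ?_
    rw [integral_const_mul, Real.integral_rpow_mul_exp_neg_mul_Ioi (by linarith) hx, one_div,
      Real.inv_rpow (le_of_lt hx), ← Real.rpow_neg (le_of_lt hx),
      show -(2 * d + 2) = -2 - 2 * d by ring]
    ring
  have hR : ∫ t in Ioi (0 : ℝ), ∫ x in Ioi (0 : ℝ),
      (1 - Real.cos x) * (t ^ (2 * d + 2 - 1) * Real.exp (-(x * t))) =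
      ∫ t in Ioi (0 : ℝ), t ^ (2 * d) / (t ^ 2 + 1) := by
    refine setIntegral_congr_fun measurableSet_Ioi fun t ht => ?_
    simp_rw [mul_left_comm (1 - Real.cos _)]
    rw [integral_const_mul, (integral_one_sub_cos_mul_exp_neg ht).2,
      show 2 * d + 2 - 1 = 2 * d + 1 by ring, Real.rpow_add_one (ne_of_gt ht)]
    have : (t : ℝ) ≠ 0 := ne_of_gt ht
    field_simp
  rw [hL, hR, integral_rpow_div_one_add_sq (by linarith) hd'] at h
  rw [mul_comm] at h
  rw [eq_div_of_mul_eq hG.ne' h]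
  rw [div_div]

theorem normSq_one_sub_exp_I_mul (x : ℝ) :
    ‖1 - Complex.exp (Complex.I * (x : ℂ))‖ ^ 2 = 2 * (1 - Real.cos x) := by
  rw [← Complex.normSq_eq_norm_sq, mul_comm, Complex.exp_mul_I, Complex.normSq_apply]
  simp [← Complex.ofReal_cos, ← Complex.ofReal_sin]
  nlinarith [Real.sin_sq_add_cos_sq x]

/-- One factor 2 comes from `|1-e^{ix}|² = 2(1 - cos x)`, another from evenness; `Γ(2d+2) = (2d+1)
Γ(2d+1)` absorbs them. -/
theorem integral_kappaIntegrand {d : ℝ} (hd : 0 < d) (hd' : d < 1 / 2) :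
    ∫ x : ℝ, kappaIntegrand d x =
      Real.pi / ((d + 1 / 2) * Real.Gamma (2 * d + 1) * Real.cos (Real.pi * d)) := by
  have h1 : ∀ x : ℝ, kappaIntegrand d x =
      (fun r : ℝ => 2 * ((1 - Real.cos r) * r ^ (-2 - 2 * d))) |x| := by
    intro x
    simp only [kappaIntegrand, normSq_one_sub_exp_I_mul, Real.cos_abs, mul_assoc]
  simp_rw [h1]
  rw [integral_comp_abs (f := fun r : ℝ => 2 * ((1 - Real.cos r) * r ^ (-2 - 2 * d))),
    integral_const_mul, integral_one_sub_cos_mul_rpow hd hd',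
    show 2 * d + 2 = (2 * d + 1) + 1 by ring, Real.Gamma_add_one (by linarith)]
  have hc : Real.cos (Real.pi * d) ≠ 0 := by
    refine (Real.cos_pos_of_mem_Ioo ⟨?_, ?_⟩).ne' <;> nlinarith [Real.pi_pos]
  have hG : Real.Gamma (2 * d + 1) ≠ 0 := (Real.Gamma_pos_of_pos (by linarith)).ne'
  have : 2 * d + 1 ≠ 0 := by linarith
  have : d + 1 / 2 ≠ 0 := by linarith
  field_simp

theorem kappa_sq (d : ℝ) :
    kappa d ^ 2 = ∫ x : ℝ, kappaIntegrand d x := by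
  refine Real.sq_sqrt (integral_nonneg fun x => ?_)
  simp only [kappaIntegrand]
  positivity

theorem kappa_pos {d : ℝ} (hd : 0 < d) (hd' : d < 1 / 2) : 0 < kappa d := by
  refine Real.sqrt_pos.2 ?_
  rw [integral_kappaIntegrand hd hd']
  have hc : 0 < Real.cos (Real.pi * d) := by
    refine Real.cos_pos_of_mem_Ioo ⟨?_, ?_⟩ <;> nlinarith [Real.pi_pos]
  have hG : 0 < Real.Gamma (2 * d + 1) := Real.Gamma_pos_of_pos (by linarith)
  positivity

/-! ### Fractional Brownian covariance in the spectral domain -/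

open ComplexConjugate

/-- The integrable majorant of the squared moduli of the normalized transfer functions. -/
noncomputable def decay (d s : ℝ) : ℝ := (min 1 |s|⁻¹) ^ 2 * |s| ^ (-2 * d)

theorem measurable_decay (d : ℝ) : Measurable (decay d) := by
  unfold decay
  fun_prop

theorem decay_nonneg (d s : ℝ) : 0 ≤ decay d s := by
  unfold decay
  positivity

-- Near 0 the weight `|s|^{-2d}` is integrable because `2d < 1`; at infinity the squared minimum
-- supplies the missing `s^{-2}`. The negative half-line follows by evenness.
open Set in
theorem integrable_decay {d : ℝ} (hd : 0 < d) (hd' : d < 1 / 2) : Integrable (decay d) := by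
  have h : IntegrableOn (decay d) (Ioi 0) := by
    rw [← Ioc_union_Ioi_eq_Ioi (zero_le_one' ℝ)]
    refine IntegrableOn.union ?_ ?_
    · have h1 : IntegrableOn (fun s : ℝ => s ^ (-2 * d)) (Ioc 0 1) := by
        rw [← intervalIntegrable_iff_integrableOn_Ioc_of_le zero_le_one]
        exact intervalIntegral.intervalIntegrable_rpow' (by linarith)
      refine h1.mono' (measurable_decay d).aestronglyMeasurable ?_
      filter_upwards [ae_restrict_mem measurableSet_Ioc] with s hs
      rw [Real.norm_of_nonneg (decay_nonneg d s), decay, abs_of_pos hs.1]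
      have : (min 1 s⁻¹) ^ 2 ≤ 1 := pow_le_one₀ (by have := hs.1; positivity) (min_le_left _ _)
      exact mul_le_of_le_one_left (Real.rpow_nonneg hs.1.le _) this
    · have h1 : IntegrableOn (fun s : ℝ => s ^ (-2 - 2 * d)) (Ioi 1) :=
        integrableOn_Ioi_rpow_of_lt (by linarith) one_pos
      refine h1.mono' (measurable_decay d).aestronglyMeasurable ?_
      filter_upwards [ae_restrict_mem measurableSet_Ioi] with s hs
      have hs0 : (0 : ℝ) < s := one_pos.trans hs
      rw [Real.norm_of_nonneg (decay_nonneg d s), decay, abs_of_pos hs0, sub_eq_add_neg,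
        Real.rpow_add hs0, neg_mul, Real.rpow_neg hs0.le 2, Real.rpow_two, ← inv_pow]
      gcongr
      exact min_le_right _ _
  have h' : IntegrableOn (decay d) (Iic 0) := by
    rw [integrableOn_Iic_iff_integrableOn_Iio]
    have h2 := ((Measure.measurePreserving_neg (volume : Measure ℝ)).integrableOn_comp_preimage
      (MeasurableEquiv.neg ℝ).measurableEmbedding).2 h
    have h3 : decay d ∘ Neg.neg = decay d := by
      ext s
      simp [decay]
    have h4 : (Neg.neg ⁻¹' Ioi 0 : Set ℝ) = Iio 0 := by
      ext s
      simp
    rwa [h3, h4] at h2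
  rw [← integrableOn_univ, ← Iic_union_Ioi (a := (0 : ℝ))]
  exact h'.union h

/-- The Fourier transform `(e^{ixs} - 1) / (is)` of the indicator function of `(0, x]`. -/
noncomputable def indicatorFourier (x s : ℝ) : ℂ :=
  (Complex.exp (Complex.I * (x * s : ℝ)) - 1) / (Complex.I * s)

theorem measurable_indicatorFourier (x : ℝ) : Measurable (indicatorFourier x) := by
  unfold indicatorFourier
  fun_prop

theorem norm_exp_I_mul_sub_one_le_two (r : ℝ) : ‖Complex.exp (Complex.I * r) - 1‖ ≤ 2 := by
  refine (norm_sub_le _ _).trans ?_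
  rw [mul_comm, Complex.norm_exp_ofReal_mul_I, norm_one]
  norm_num

theorem norm_indicatorFourier_le (x s : ℝ) :
    ‖indicatorFourier x s‖ ≤ (|x| + 2) * min 1 |s|⁻¹ := by
  -- At `s = 0` the quotient is 0 by the convention on division, not the analytic value `x`; the
  -- bound holds for either.
  rcases eq_or_ne s 0 with rfl | hs
  · simp [indicatorFourier]
  have hs' : 0 < |s| := abs_pos.2 hs
  have hn : ‖indicatorFourier x s‖ = ‖Complex.exp (Complex.I * (x * s : ℝ)) - 1‖ / |s| := by
    rw [indicatorFourier, norm_div, norm_mul, Complex.norm_I, one_mul, Complex.norm_real,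
      Real.norm_eq_abs]
  rw [hn, mul_min_of_nonneg _ _ (by positivity)]
  refine le_min ?_ ?_
  · rw [div_le_iff₀ hs']
    have := Real.norm_exp_I_mul_ofReal_sub_one_le (x := x * s)
    rw [Real.norm_eq_abs, abs_mul] at this
    nlinarith
  · rw [div_eq_mul_inv]
    gcongr
    have := norm_exp_I_mul_sub_one_le_two (x * s)
    linarith [abs_nonneg x]

theorem norm_indicatorFourier_mul_conj_le (d x x' s : ℝ) :
    ‖indicatorFourier x s * conj (indicatorFourier x' s) * ((|s| ^ (-2 * d) : ℝ) : ℂ)‖ ≤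
      (|x| + 2) * (|x'| + 2) * decay d s := by
  rw [norm_mul, norm_mul, Complex.norm_conj, Complex.norm_real,
    Real.norm_of_nonneg (Real.rpow_nonneg (abs_nonneg s) _), decay]
  calc _ ≤ ((|x| + 2) * min 1 |s|⁻¹) * ((|x'| + 2) * min 1 |s|⁻¹) * |s| ^ (-2 * d) := by
        gcongr <;> exact norm_indicatorFourier_le _ _
    _ = _ := by ring

theorem integrable_indicatorFourier_mul_conj {d : ℝ} (hd : 0 < d) (hd' : d < 1 / 2) (x x' : ℝ) :
    Integrable fun s =>
      indicatorFourier x s * conj (indicatorFourier x' s) * ((|s| ^ (-2 * d) : ℝ) : ℂ) := by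
  refine ((integrable_decay hd hd').const_mul ((|x| + 2) * (|x'| + 2))).mono' ?_
    (ae_of_all _ fun s => norm_indicatorFourier_mul_conj_le d x x' s)
  refine Measurable.aestronglyMeasurable ?_
  have h1 := measurable_indicatorFourier x
  have h2 := Complex.continuous_conj.measurable.comp (measurable_indicatorFourier x')
  exact (h1.mul h2).mul (by fun_prop)

theorem kappaIntegrand_eq_indicatorFourier (d : ℝ) {s : ℝ} (hs : s ≠ 0) :
    kappaIntegrand d s = ‖indicatorFourier 1 s‖ ^ 2 * |s| ^ (-2 * d) := by
  have hs' : 0 < |s| := abs_pos.2 hs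
  rw [kappaIntegrand, indicatorFourier, norm_div, norm_mul, Complex.norm_I, one_mul, one_mul,
    Complex.norm_real, Real.norm_eq_abs, norm_sub_rev, div_pow,
    show -2 - 2 * d = -2 + -2 * d by ring, Real.rpow_add hs', Real.rpow_neg hs'.le 2, Real.rpow_two]
  ring

theorem integrable_kappaIntegrand {d : ℝ} (hd : 0 < d) (hd' : d < 1 / 2) :
    Integrable (kappaIntegrand d) := by
  refine (integrable_indicatorFourier_mul_conj hd hd' 1 1).norm.congr ?_
  filter_upwards [compl_mem_ae_iff.2 (measure_singleton (μ := volume) (0 : ℝ))] with s hs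
  rw [kappaIntegrand_eq_indicatorFourier d hs, norm_mul, norm_mul, Complex.norm_conj,
    Complex.norm_real, Real.norm_of_nonneg (Real.rpow_nonneg (abs_nonneg s) _), sq]

/-- The dilated integrand of `κ(d)²`. -/
theorem norm_sq_mul_rpow_eq {d x : ℝ} (hx : x ≠ 0) (s : ℝ) :
    2 * (1 - Real.cos (x * s)) * |s| ^ (-2 - 2 * d) =
      |x| ^ (2 + 2 * d) * kappaIntegrand d (x * s) := by
  have hx' : 0 < |x| := abs_pos.2 hx
  rw [kappaIntegrand, normSq_one_sub_exp_I_mul, abs_mul, Real.mul_rpow (abs_nonneg x) (abs_nonneg s),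
    show -2 - 2 * d = -(2 + 2 * d) by ring, Real.rpow_neg hx'.le]
  have : |x| ^ (2 + 2 * d) ≠ 0 := (Real.rpow_pos_of_pos hx' _).ne'
  field_simp

theorem integrable_one_sub_cos_mul_rpow {d : ℝ} (hd : 0 < d) (hd' : d < 1 / 2) (x : ℝ) :
    Integrable fun s => 2 * (1 - Real.cos (x * s)) * |s| ^ (-2 - 2 * d) := by
  rcases eq_or_ne x 0 with rfl | hx
  · simp
  simp_rw [norm_sq_mul_rpow_eq hx]
  exact ((integrable_kappaIntegrand hd hd').comp_mul_left' hx).const_mul _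

/-- Dilation `s ↦ x s` extracts `|x|^{2+2d}` from the weight and loses one power to the Jacobian:
this is self-similarity with index `d + 1/2`. -/
theorem integral_one_sub_cos_mul_rpow_abs {d : ℝ} (hd : 0 < d) (x : ℝ) :
    ∫ s : ℝ, 2 * (1 - Real.cos (x * s)) * |s| ^ (-2 - 2 * d) =
      kappa d ^ 2 * |x| ^ (2 * (d + 1 / 2)) := by
  rcases eq_or_ne x 0 with rfl | hx
  · rw [abs_zero, Real.zero_rpow (by linarith)]
    simp
  simp_rw [norm_sq_mul_rpow_eq hx]
  have hx' : 0 < |x| := abs_pos.2 hx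
  rw [integral_const_mul, Measure.integral_comp_mul_left, ← kappa_sq, smul_eq_mul, abs_inv,
    show 2 + 2 * d = 2 * (d + 1 / 2) + 1 by ring, Real.rpow_add_one hx'.ne']
  field_simp

theorem indicatorFourier_neg (x s : ℝ) :
    indicatorFourier x (-s) = conj (indicatorFourier x s) := by
  simp [indicatorFourier, ← Complex.exp_conj]

/-- Polarization `2 Re(u v̄) = |u|² + |v|² - |u - v|²` with `u = e^{ixs} - 1`, `v = e^{ix's} - 1`,
where `|u - v| = |e^{i(x-x')s} - 1|`. -/
theorem re_indicatorFourier_mul_conj (d x x' : ℝ) {s : ℝ} (hs : s ≠ 0) :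
    (indicatorFourier x s * conj (indicatorFourier x' s) * ((|s| ^ (-2 * d) : ℝ) : ℂ)).re =
      1 / 2 * (2 * (1 - Real.cos (x * s)) * |s| ^ (-2 - 2 * d)
        + 2 * (1 - Real.cos (x' * s)) * |s| ^ (-2 - 2 * d)
        - 2 * (1 - Real.cos ((x - x') * s)) * |s| ^ (-2 - 2 * d)) := by
  have hs' : 0 < |s| := abs_pos.2 hs
  have hsc : (s : ℂ) ≠ 0 := by exact_mod_cast hs
  have h : indicatorFourier x s * conj (indicatorFourier x' s) =
      (Complex.exp ((x * s : ℝ) * Complex.I) - 1) * conj (Complex.exp ((x' * s : ℝ) * Complex.I) - 1)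
        * (((s ^ 2)⁻¹ : ℝ) : ℂ) := by
    rw [indicatorFourier, indicatorFourier, map_div₀, map_mul, Complex.conj_I, Complex.conj_ofReal,
      mul_comm Complex.I ((x * s : ℝ) : ℂ), mul_comm Complex.I ((x' * s : ℝ) : ℂ)]
    push_cast
    field_simp
    rw [Complex.I_sq]
    ring
  rw [h, Complex.re_mul_ofReal, Complex.re_mul_ofReal, show -2 - 2 * d = -2 + -2 * d by ring,
    Real.rpow_add hs', Real.rpow_neg hs'.le 2, Real.rpow_two, sq_abs, sub_mul x x' s, Real.cos_sub,
    Complex.exp_mul_I, Complex.exp_mul_I]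
  generalize x * s = a
  generalize x' * s = b
  simp [Complex.cos_ofReal_re, Complex.sin_ofReal_re, -Complex.ofReal_cos, -Complex.ofReal_sin]
  ring

/-- The covariance of a fractional Brownian motion, in the spectral domain. -/
theorem integral_indicatorFourier_mul_conj {d : ℝ} (hd : 0 < d) (hd' : d < 1 / 2) (x x' : ℝ) :
    ∫ s : ℝ, indicatorFourier x s * conj (indicatorFourier x' s) * ((|s| ^ (-2 * d) : ℝ) : ℂ) =
      ((kappa d ^ 2 * (1 / 2 * (|x| ^ (2 * (d + 1 / 2)) + |x'| ^ (2 * (d + 1 / 2))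
        - |x - x'| ^ (2 * (d + 1 / 2)))) : ℝ) : ℂ) := by
  set F : ℝ → ℂ := fun s =>
    indicatorFourier x s * conj (indicatorFourier x' s) * ((|s| ^ (-2 * d) : ℝ) : ℂ) with hF
  -- The integrand satisfies `F(-s) = conj F(s)`, so its integral is real and only the real part has
  -- to be computed.
  have hconj : conj (∫ s, F s) = ∫ s, F s := by
    rw [← integral_conj, ← integral_neg_eq_self F]
    refine integral_congr_ae (ae_of_all _ fun s => ?_)
    simp [hF, indicatorFourier_neg]
  rw [← Complex.conj_eq_iff_re.1 hconj]
  congr 1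
  have hre : (∫ s, F s).re = ∫ s, (F s).re :=
    (integral_re (integrable_indicatorFourier_mul_conj hd hd' x x')).symm
  rw [hre]
  have h1 := integrable_one_sub_cos_mul_rpow hd hd' x
  have h2 := integrable_one_sub_cos_mul_rpow hd hd' x'
  have h3 := integrable_one_sub_cos_mul_rpow hd hd' (x - x')
  have hae : (fun s => (F s).re) =ᵐ[volume] fun s =>
      1 / 2 * (2 * (1 - Real.cos (x * s)) * |s| ^ (-2 - 2 * d)
        + 2 * (1 - Real.cos (x' * s)) * |s| ^ (-2 - 2 * d)
        - 2 * (1 - Real.cos ((x - x') * s)) * |s| ^ (-2 - 2 * d)) := by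
    filter_upwards [compl_mem_ae_iff.2 (measure_singleton (μ := volume) (0 : ℝ))] with s hs
    exact re_indicatorFourier_mul_conj d x x' hs
  have h12 : Integrable fun s => 2 * (1 - Real.cos (x * s)) * |s| ^ (-2 - 2 * d)
      + 2 * (1 - Real.cos (x' * s)) * |s| ^ (-2 - 2 * d) := h1.add h2
  rw [integral_congr_ae hae, integral_const_mul, integral_sub h12 h3, integral_add h1 h2]
  simp only [integral_one_sub_cos_mul_rpow_abs hd]
  ring

/-! ### The Dirichlet kernel -/

/-- The sum `∑_{t=1}^N e^{itu}`. -/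
noncomputable def expSum (N : ℤ) (u : ℝ) : ℂ :=
  ∑ t ∈ Finset.Icc (1 : ℤ) N, Complex.exp (Complex.I * (t * u : ℝ))

theorem continuous_expSum (N : ℤ) : Continuous (expSum N) := by
  unfold expSum
  fun_prop

theorem norm_expSum_le (N : ℤ) (u : ℝ) : ‖expSum N u‖ ≤ N.toNat := by
  refine (norm_sum_le _ _).trans ?_
  simp [mul_comm Complex.I, Complex.norm_exp_ofReal_mul_I, -Complex.ofReal_mul]

/-- The geometric sum, kept in multiplied-out form so that no frequency has to be excluded. -/
theorem expSum_mul (n : ℕ) (u : ℝ) :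
    expSum n u * (Complex.exp (Complex.I * u) - 1) =
      Complex.exp (Complex.I * u) * (Complex.exp (Complex.I * (n * u : ℝ)) - 1) := by
  induction n with
  | zero => simp [expSum]
  | succ n ih =>
    have h : Finset.Icc (1 : ℤ) ((n + 1 : ℕ) : ℤ) =
        insert ((n : ℤ) + 1) (Finset.Icc (1 : ℤ) n) := by
      ext k
      simp only [Finset.mem_Icc, Finset.mem_insert]
      omega
    rw [expSum, h, Finset.sum_insert (by simp), add_mul]
    change _ + expSum n u * _ = _
    rw [ih]
    have he : ∀ m : ℕ, Complex.exp (Complex.I * (((m : ℤ) + 1 : ℤ) * u : ℝ)) =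
        Complex.exp (Complex.I * (m * u : ℝ)) * Complex.exp (Complex.I * u) := by
      intro m
      rw [← Complex.exp_add]
      push_cast
      ring_nf
    have he' := he n
    push_cast at he' ⊢
    rw [he']
    ring

/-- Jordan's inequality gives `|e^{iu} - 1| = 2|sin(u/2)| ≥ (2/π)|u|` on `[-π, π]`. -/
theorem norm_expSum_le_div (n : ℕ) {u : ℝ} (hu : u ≠ 0) (hu' : |u| ≤ Real.pi) :
    ‖expSum n u‖ ≤ Real.pi / |u| := by
  have h := congrArg norm (expSum_mul n u)
  rw [norm_mul, norm_mul, mul_comm Complex.I (u : ℂ), Complex.norm_exp_ofReal_mul_I, one_mul,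
    mul_comm (u : ℂ)] at h
  have h2 := norm_exp_I_mul_sub_one_le_two (n * u)
  have hlow : 2 / Real.pi * |u| ≤ ‖Complex.exp (Complex.I * u) - 1‖ := by
    rw [Complex.norm_exp_I_mul_ofReal_sub_one, norm_mul, Real.norm_eq_abs, Real.norm_eq_abs,
      abs_two]
    have := Real.mul_abs_le_abs_sin (x := u / 2) (by rw [abs_div, abs_two]; linarith)
    rw [abs_div, abs_two] at this
    linarith
  have hp := Real.pi_pos
  have hu0 : 0 < |u| := abs_pos.2 hu
  rw [le_div_iff₀ hu0]
  have h3 : ‖expSum n u‖ * (2 / Real.pi * |u|) ≤ 2 := by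
    refine le_trans ?_ h2
    rw [← h]
    gcongr
  calc ‖expSum n u‖ * |u| = ‖expSum n u‖ * (2 / Real.pi * |u|) * (Real.pi / 2) := by
        field_simp
    _ ≤ 2 * (Real.pi / 2) := by gcongr
    _ = Real.pi := by ring

/-- The number of terms controls low frequencies and the Jordan bound high ones. The result does not
depend on `a`, which is what dominated convergence needs. -/
theorem norm_scaled_expSum_le {a x s : ℝ} (ha : 0 < a) (hx : 0 ≤ x) (hs : s ≠ 0)
    (hs' : |s / a| ≤ Real.pi) :
    ‖((a⁻¹ : ℝ) : ℂ) * expSum ⌊a * x⌋ (s / a)‖ ≤ (x + Real.pi) * min 1 |s|⁻¹ := by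
  have hp := Real.pi_pos
  have hs0 : 0 < |s| := abs_pos.2 hs
  obtain ⟨n, hn⟩ := Int.eq_ofNat_of_zero_le (Int.floor_nonneg.2 (mul_nonneg ha.le hx))
  have hna : (n : ℝ) ≤ a * x := by
    have := Int.floor_le (a * x)
    rw [hn] at this
    exact_mod_cast this
  rw [hn, norm_mul, Complex.norm_real, Real.norm_of_nonneg (inv_nonneg.2 ha.le),
    mul_min_of_nonneg _ _ (by positivity)]
  refine le_min ?_ ?_
  · have := norm_expSum_le n (s / a)
    simp only [Int.toNat_natCast] at this
    rw [inv_mul_le_iff₀ ha]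
    nlinarith
  · have := norm_expSum_le_div n (div_ne_zero hs ha.ne') hs'
    rw [inv_mul_le_iff₀ ha]
    refine this.trans ?_
    rw [abs_div, abs_of_pos ha]
    have : Real.pi / (|s| / a) = a * (Real.pi * |s|⁻¹) := by field_simp
    rw [this]
    gcongr
    linarith

theorem tendsto_scaled_expSum {a : ℕ → ℝ} (ha : Tendsto a atTop atTop) {x s : ℝ} (hx : 0 ≤ x)
    (hs : s ≠ 0) :
    Tendsto (fun n => (((a n)⁻¹ : ℝ) : ℂ) * expSum ⌊a n * x⌋ (s / a n)) atTop
      (𝓝 (indicatorFourier x s)) := by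
  have hinv : Tendsto (fun n => (a n)⁻¹) atTop (𝓝 0) := tendsto_inv_atTop_zero.comp ha
  have hsa : Tendsto (fun n => s / a n) atTop (𝓝 0) := by
    simpa [div_eq_mul_inv] using hinv.const_mul s
  have hsa' : Tendsto (fun n => s / a n) atTop (𝓝[≠] 0) := by
    refine tendsto_nhdsWithin_iff.2 ⟨hsa, ?_⟩
    filter_upwards [ha.eventually_gt_atTop 0] with n hn
    exact div_ne_zero hs hn.ne'
  have hexp : Tendsto (fun n => Complex.exp (Complex.I * (s / a n : ℝ))) atTop (𝓝 1) := by
    have : Continuous fun r : ℝ => Complex.exp (Complex.I * r) := by fun_prop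
    simpa [Function.comp_def] using (this.tendsto 0).comp hsa
  -- The limit is the derivative of `r ↦ e^{ir}` at 0, read along `r = s / a n`.
  have hden : Tendsto (fun n => (a n : ℂ) * (Complex.exp (Complex.I * (s / a n : ℝ)) - 1)) atTop
      (𝓝 (Complex.I * s)) := by
    have hd : HasDerivAt (fun r : ℝ => Complex.exp (Complex.I * r)) Complex.I 0 := by
      have := ((hasDerivAt_id (0 : ℂ)).const_mul Complex.I).cexp.comp_ofReal (z := 0)
      simpa using this
    have h := (hasDerivAt_iff_tendsto_slope.1 hd).comp hsa'
    have h2 := h.mul_const (s : ℂ)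
    refine h2.congr' ?_
    filter_upwards [ha.eventually_gt_atTop 0] with n hn
    have h1 : (a n : ℂ) ≠ 0 := by exact_mod_cast hn.ne'
    have h3 : (s : ℂ) ≠ 0 := by exact_mod_cast hs
    simp only [Function.comp, slope, vsub_eq_sub, sub_zero, Complex.ofReal_zero, mul_zero,
      Complex.exp_zero, Complex.real_smul]
    push_cast
    field_simp
  have hfl : Tendsto (fun n => (⌊a n * x⌋ : ℝ) * (s / a n)) atTop (𝓝 (x * s)) := by
    have h := ((tendsto_nat_floor_mul_div_atTop hx).comp ha).mul_const s
    refine h.congr' ?_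
    filter_upwards [ha.eventually_gt_atTop 0] with n hn
    rw [Function.comp, mul_comm x, natCast_floor_eq_intCast_floor (by positivity)]
    ring
  have hnum : Tendsto (fun n => Complex.exp (Complex.I * (s / a n : ℝ)) *
      (Complex.exp (Complex.I * ((⌊a n * x⌋ : ℝ) * (s / a n) : ℝ)) - 1)) atTop
      (𝓝 (1 * (Complex.exp (Complex.I * (x * s : ℝ)) - 1))) := by
    have : Continuous fun r : ℝ => Complex.exp (Complex.I * r) := by fun_prop
    exact hexp.mul (((this.tendsto _).comp hfl).sub_const 1)
  have hIs : Complex.I * (s : ℂ) ≠ 0 := mul_ne_zero Complex.I_ne_zero (by exact_mod_cast hs)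
  have h := hnum.div hden hIs
  rw [one_mul] at h
  refine h.congr' ?_
  filter_upwards [ha.eventually_gt_atTop 0, hden.eventually_ne hIs] with n hn hne
  obtain ⟨k, hk⟩ := Int.eq_ofNat_of_zero_le (Int.floor_nonneg.2 (mul_nonneg hn.le hx))
  have hm := expSum_mul k (s / a n)
  have h0 := right_ne_zero_of_mul hne
  have h1 : (a n : ℂ) ≠ 0 := left_ne_zero_of_mul hne
  rw [Pi.div_apply, hk, Int.cast_natCast, ← hm]
  rw [Complex.ofReal_inv]
  field_simp

/-! ### Rescaling of the frequency plane -/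

theorem map_div_prod_volume {a b : ℝ} (ha : 0 < a) (hb : 0 < b) :
    Measure.map (fun z : ℝ × ℝ => (z.1 / a, z.2 / b)) volume =
      ENNReal.ofReal (a * b) • (volume : Measure (ℝ × ℝ)) := by
  have h1 : ∀ c : ℝ, 0 < c →
      Measure.map (fun s : ℝ => s / c) volume = ENNReal.ofReal c • (volume : Measure ℝ) := by
    intro c hc
    simp_rw [div_eq_mul_inv]
    rw [Real.map_volume_mul_right (inv_ne_zero hc.ne'), inv_inv, abs_of_pos hc]
  have h := Measure.map_prod_map (volume : Measure ℝ) (volume : Measure ℝ)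
    (measurable_id.div_const a) (measurable_id.div_const b)
  simp only [id] at h
  rw [h1 a ha, h1 b hb, Measure.prod_smul_left, Measure.prod_smul_right, smul_smul,
    ← ENNReal.ofReal_mul ha.le] at h
  exact h.symm

theorem integral_comp_div_prod {a b : ℝ} (ha : 0 < a) (hb : 0 < b) (G : ℝ × ℝ → ℂ) :
    ∫ z : ℝ × ℝ, G (z.1 / a, z.2 / b) = ((a * b : ℝ) : ℂ) * ∫ z, G z := by
  let e : ℝ × ℝ ≃ᵐ ℝ × ℝ := 
    (MeasurableEquiv.mulRight₀ a⁻¹ (inv_ne_zero ha.ne')).prodCongr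
      (MeasurableEquiv.mulRight₀ b⁻¹ (inv_ne_zero hb.ne'))
  have h := integral_map_equiv (μ := volume) e G
  have he : ∀ z, e z = (z.1 / a, z.2 / b) := fun z =>
    Prod.ext (div_eq_mul_inv _ _).symm (div_eq_mul_inv _ _).symm
  simp only [he] at h
  rw [← h]
  have he' : (⇑e) = fun z : ℝ × ℝ => (z.1 / a, z.2 / b) := funext he
  rw [he', map_div_prod_volume ha hb, integral_smul_measure,
    ENNReal.toReal_ofReal (by positivity), Complex.real_smul]

/-- Only almost everywhere measurability of `G` is available, because `g` is not assumed measurable.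
It survives the dilation since the image of Lebesgue measure is a multiple of Lebesgue measure. -/
theorem aestronglyMeasurable_comp_div_prod {a b : ℝ} (ha : 0 < a) (hb : 0 < b) {G : ℝ × ℝ → ℂ}
    (hG : AEStronglyMeasurable G volume) :
    AEStronglyMeasurable (fun z : ℝ × ℝ => G (z.1 / a, z.2 / b)) volume := by
  have hm : Measurable fun z : ℝ × ℝ => (z.1 / a, z.2 / b) := by fun_prop
  have : AEStronglyMeasurable G
      (Measure.map (fun z : ℝ × ℝ => (z.1 / a, z.2 / b)) volume) := by
    rw [map_div_prod_volume ha hb]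
    exact hG.mono_ac (Measure.smul_absolutelyContinuous)
  exact this.comp_measurable hm

/-! ### The covariance of the partial sums -/

theorem measurableSet_freqSquare : MeasurableSet freqSquare :=
  measurableSet_Icc.prod measurableSet_Icc

theorem expSum_mul_conj_mul (M M' N N' : ℤ) (u v : ℝ) :
    expSum M u * conj (expSum M' u) * (expSum N v * conj (expSum N' v)) =
      ∑ p ∈ Finset.Icc (1 : ℤ) M ×ˢ Finset.Icc (1 : ℤ) N,
      ∑ q ∈ Finset.Icc (1 : ℤ) M' ×ˢ Finset.Icc (1 : ℤ) N',
        Complex.exp (Complex.I *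
          (((p.1 - q.1 : ℤ) : ℂ) * (u : ℂ) + ((p.2 - q.2 : ℤ) : ℂ) * (v : ℂ))) := by
  rw [mul_mul_mul_comm]
  have h' : ∀ M N : ℤ, expSum M u * expSum N v =
      ∑ p ∈ Finset.Icc (1 : ℤ) M ×ˢ Finset.Icc (1 : ℤ) N,
        Complex.exp (Complex.I * (p.1 * u : ℝ)) * Complex.exp (Complex.I * (p.2 * v : ℝ)) := by
    intro M N
    rw [expSum, expSum, Finset.sum_mul_sum, Finset.sum_product]
  rw [← map_mul, h', h', map_sum, Finset.sum_mul_sum]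
  refine Finset.sum_congr rfl fun p _ => Finset.sum_congr rfl fun q _ => ?_
  rw [← Complex.exp_add, ← Complex.exp_add, ← Complex.exp_conj, ← Complex.exp_add]
  congr 1
  simp
  ring

theorem integrable_expSum_mul {f : ℝ × ℝ → ℝ} (hf : IntegrableOn f freqSquare) (M M' N N' : ℤ) :
    IntegrableOn (fun z : ℝ × ℝ => expSum M z.1 * conj (expSum M' z.1) *
      (expSum N z.2 * conj (expSum N' z.2)) * (f z : ℂ)) freqSquare := by
  have hc : Continuous fun z : ℝ × ℝ => expSum M z.1 * conj (expSum M' z.1) *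
      (expSum N z.2 * conj (expSum N' z.2)) := by
    have h := continuous_expSum
    exact (((h M).comp continuous_fst).mul (Complex.continuous_conj.comp
      ((h M').comp continuous_fst))).mul (((h N).comp continuous_snd).mul
      (Complex.continuous_conj.comp ((h N').comp continuous_snd)))
  refine Integrable.bdd_mul (c := (M.toNat * M'.toNat : ℝ) * (N.toNat * N'.toNat)) hf.ofReal
    hc.aestronglyMeasurable (ae_of_all _ fun z => ?_)
  simp only [norm_mul, Complex.norm_conj]
  gcongr <;> exact norm_expSum_le _ _

/-- Bilinearity turns the covariance into a double sum of spectral integrals; the sum of the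
exponentials factors into Dirichlet kernels, one pair per coordinate. -/
theorem covariance_sum_box {Ω : Type*} [MeasurableSpace Ω] {P : Measure Ω} [IsProbabilityMeasure P]
    {Y : ℤ × ℤ → Ω → ℝ} {f : ℝ × ℝ → ℝ} (hY : ∀ t, MemLp (Y t) 2 P)
    (hf : IsSpectralDensity Y P f) (M M' N N' : ℤ) :
    ((cov[fun ω => ∑ p ∈ Finset.Icc (1 : ℤ) M ×ˢ Finset.Icc (1 : ℤ) N, Y p ω,
      fun ω => ∑ q ∈ Finset.Icc (1 : ℤ) M' ×ˢ Finset.Icc (1 : ℤ) N', Y q ω; P] : ℝ) : ℂ) =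
      ∫ z in freqSquare, expSum M z.1 * conj (expSum M' z.1) *
      (expSum N z.2 * conj (expSum N' z.2)) * (f z : ℂ) := by
  have hint : ∀ p q : ℤ × ℤ, IntegrableOn (fun z : ℝ × ℝ => Complex.exp (Complex.I *
      (((p.1 - q.1 : ℤ) : ℂ) * (z.1 : ℂ) + ((p.2 - q.2 : ℤ) : ℂ) * (z.2 : ℂ))) * (f z : ℂ))
      freqSquare := by
    intro p q
    refine Integrable.bdd_mul (c := 1) hf.integrable.ofReal
      (Continuous.aestronglyMeasurable (by fun_prop)) (ae_of_all _ fun z => ?_)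
    rw [mul_comm Complex.I]
    have := Complex.norm_exp_ofReal_mul_I
      ((p.1 - q.1 : ℤ) * z.1 + (p.2 - q.2 : ℤ) * z.2)
    push_cast at this ⊢
    exact this.le
  rw [covariance_fun_sum_fun_sum' (fun i _ => hY i) (fun j _ => hY j)]
  simp_rw [expSum_mul_conj_mul, Finset.sum_mul]
  rw [integral_finsetSum _ fun p _ => integrable_finsetSum _ fun q _ => hint p q]
  rw [Complex.ofReal_sum]
  refine Finset.sum_congr rfl fun p _ => ?_
  rw [Complex.ofReal_sum, integral_finsetSum _ fun q _ => hint p q]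
  exact Finset.sum_congr rfl fun q _ => hf.cov_eq p q

/-! ### The limit of the covariances -/

/-- The product of the normalized transfer functions, weighted by `|s|^{-2d}`. -/
noncomputable def transfer (d a x x' s : ℝ) : ℂ :=
  (((a⁻¹ : ℝ) : ℂ) * expSum ⌊a * x⌋ (s / a)) * conj (((a⁻¹ : ℝ) : ℂ) * expSum ⌊a * x'⌋ (s / a)) *
    ((|s| ^ (-2 * d) : ℝ) : ℂ)

theorem norm_transfer_le {d a x x' s : ℝ} (ha : 0 < a) (hx : 0 ≤ x) (hx' : 0 ≤ x') (hs : s ≠ 0)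
    (hs' : |s / a| ≤ Real.pi) :
    ‖transfer d a x x' s‖ ≤ (x + Real.pi) * (x' + Real.pi) * decay d s := by
  rw [transfer, norm_mul, norm_mul, Complex.norm_conj, Complex.norm_real,
    Real.norm_of_nonneg (Real.rpow_nonneg (abs_nonneg s) _), decay]
  have hp := Real.pi_pos
  calc _ ≤ ((x + Real.pi) * min 1 |s|⁻¹) * ((x' + Real.pi) * min 1 |s|⁻¹) * |s| ^ (-2 * d) := by
        gcongr
        · exact norm_scaled_expSum_le ha hx hs hs'
        · exact norm_scaled_expSum_le ha hx' hs hs'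
    _ = _ := by ring

theorem tendsto_transfer {a : ℕ → ℝ} (ha : Tendsto a atTop atTop) (d : ℝ) {x x' s : ℝ}
    (hx : 0 ≤ x) (hx' : 0 ≤ x') (hs : s ≠ 0) :
    Tendsto (fun n => transfer d (a n) x x' s) atTop
      (𝓝 (indicatorFourier x s * conj (indicatorFourier x' s) * ((|s| ^ (-2 * d) : ℝ) : ℂ))) :=
  ((tendsto_scaled_expSum ha hx hs).mul
    ((Complex.continuous_conj.tendsto _).comp (tendsto_scaled_expSum ha hx' hs))).mul_const _

theorem transfer_eq (d x x' : ℝ) {a s : ℝ} (ha : 0 < a) :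
    transfer d a x x' s = ((a⁻¹ * a⁻¹ * a ^ (-2 * d) : ℝ) : ℂ) *
      (expSum ⌊a * x⌋ (s / a) * conj (expSum ⌊a * x'⌋ (s / a))) *
        (((|s / a| ^ (2 * d))⁻¹ : ℝ) : ℂ) := by
  have : |s| ^ (-2 * d) = a ^ (-2 * d) * (|s / a| ^ (2 * d))⁻¹ := by
    rw [abs_div, abs_of_pos ha, Real.div_rpow (abs_nonneg s) ha.le, neg_mul,
      Real.rpow_neg (abs_nonneg s), Real.rpow_neg ha.le]
    have : a ^ (2 * d) ≠ 0 := (Real.rpow_pos_of_pos ha _).ne'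
    field_simp
  rw [transfer, this, map_mul, Complex.conj_ofReal]
  push_cast
  ring

/-- The analytic core: dominated convergence after rescaling the frequencies. The sequences `a` and
`b` diverge independently of each other, so all `γ` are handled at once. -/
theorem tendsto_integral_expSum {d₁ d₂ : ℝ} {g : ℝ × ℝ → ℝ}
    (hd₁ : 0 < d₁) (hd₁' : d₁ < 1 / 2) (hd₂ : 0 < d₂) (hd₂' : d₂ < 1 / 2)
    (hg_nonneg : ∀ z ∈ freqSquare, 0 ≤ g z)
    (hg_bdd : ∃ C : ℝ, ∀ z ∈ freqSquare, g z ≤ C)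
    (hg_lim : Tendsto g (𝓝[≠] (0, 0)) (𝓝 1))
    (hint : IntegrableOn (fun z => g z / (|z.1| ^ (2 * d₁) * |z.2| ^ (2 * d₂))) freqSquare)
    {a b : ℕ → ℝ} (ha : Tendsto a atTop atTop) (hb : Tendsto b atTop atTop)
    {x x' y y' : ℝ} (hx : 0 ≤ x) (hx' : 0 ≤ x') (hy : 0 ≤ y) (hy' : 0 ≤ y') :
    Tendsto (fun n => ((a n ^ (-1 - 2 * d₁) * b n ^ (-1 - 2 * d₂) : ℝ) : ℂ) *
      ∫ z in freqSquare, expSum ⌊a n * x⌋ z.1 * conj (expSum ⌊a n * x'⌋ z.1) *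
        (expSum ⌊b n * y⌋ z.2 * conj (expSum ⌊b n * y'⌋ z.2)) *
        ((g z / (|z.1| ^ (2 * d₁) * |z.2| ^ (2 * d₂)) : ℝ) : ℂ)) atTop
      (𝓝 (((kappa d₁ ^ 2 * (1 / 2 * (|x| ^ (2 * (d₁ + 1 / 2)) + |x'| ^ (2 * (d₁ + 1 / 2))
          - |x - x'| ^ (2 * (d₁ + 1 / 2)))) : ℝ) : ℂ) *
        ((kappa d₂ ^ 2 * (1 / 2 * (|y| ^ (2 * (d₂ + 1 / 2)) + |y'| ^ (2 * (d₂ + 1 / 2))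
          - |y - y'| ^ (2 * (d₂ + 1 / 2)))) : ℝ) : ℂ))) := by
  obtain ⟨C, hC⟩ := hg_bdd
  have hp := Real.pi_pos
  set F : ℕ → ℝ × ℝ → ℂ := fun n z =>
    expSum ⌊a n * x⌋ z.1 * conj (expSum ⌊a n * x'⌋ z.1) *
      (expSum ⌊b n * y⌋ z.2 * conj (expSum ⌊b n * y'⌋ z.2)) *
      ((g z / (|z.1| ^ (2 * d₁) * |z.2| ^ (2 * d₂)) : ℝ) : ℂ) with hF
  -- The Jacobian `a b` of the dilation multiplies `c` to give the prefactor `a^{-1-2d₁}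
  -- b^{-1-2d₂}`.
  set c : ℕ → ℝ := fun n => ((a n)⁻¹ * (a n)⁻¹ * a n ^ (-2 * d₁)) *
    ((b n)⁻¹ * (b n)⁻¹ * b n ^ (-2 * d₂)) with hc
  set G : ℕ → ℝ × ℝ → ℂ := fun n z =>
    (c n : ℂ) * freqSquare.indicator (F n) (z.1 / a n, z.2 / b n) with hG
  have hint0 : ∀ᶠ n in atTop, ((a n ^ (-1 - 2 * d₁) * b n ^ (-1 - 2 * d₂) : ℝ) : ℂ) *
      ∫ z in freqSquare, F n z = ∫ z, G n z := by
    filter_upwards [ha.eventually_gt_atTop 0, hb.eventually_gt_atTop 0] with n han hbn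
    rw [hG]
    simp only
    rw [integral_const_mul, integral_comp_div_prod han hbn, integral_indicator
      measurableSet_freqSquare, ← mul_assoc, ← Complex.ofReal_mul]
    congr 2
    simp only [hc]
    rw [sub_eq_add_neg, Real.rpow_add han, sub_eq_add_neg, Real.rpow_add hbn, Real.rpow_neg_one,
      Real.rpow_neg_one, neg_mul, neg_mul]
    field_simp
  have hdiv : ∀ r A B : ℝ, r / (A * B) = A⁻¹ * B⁻¹ * r := by
    intro r A B
    rw [div_eq_mul_inv, mul_inv]
    ring
  have hGeq : ∀ n, 0 < a n → 0 < b n → ∀ z : ℝ × ℝ, (z.1 / a n, z.2 / b n) ∈ freqSquare →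
      G n z = transfer d₁ (a n) x x' z.1 * transfer d₂ (b n) y y' z.2 *
        (g (z.1 / a n, z.2 / b n) : ℂ) := by
    intro n han hbn z hz
    simp only [hG, Set.indicator_of_mem hz, transfer_eq _ _ _ han, transfer_eq _ _ _ hbn, hF, hc, hdiv]
    push_cast
    ring
  have hmem : ∀ n, ∀ z : ℝ × ℝ, (z.1 / a n, z.2 / b n) ∈ freqSquare ↔
      |z.1 / a n| ≤ Real.pi ∧ |z.2 / b n| ≤ Real.pi := by
    intro n z
    simp only [freqSquare, Set.mem_prod, Set.mem_Icc, abs_le]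
  have hne : ∀ᵐ z : ℝ × ℝ, z.1 ≠ 0 ∧ z.2 ≠ 0 := by
    have h0 : ∀ᵐ s : ℝ, s ≠ 0 := compl_mem_ae_iff.2 (measure_singleton 0)
    exact (Measure.quasiMeasurePreserving_fst.ae h0).and (Measure.quasiMeasurePreserving_snd.ae h0)
  have hlim : Tendsto (fun n => ∫ z, G n z) atTop (𝓝 (∫ z : ℝ × ℝ,
      (indicatorFourier x z.1 * conj (indicatorFourier x' z.1) * ((|z.1| ^ (-2 * d₁) : ℝ) : ℂ)) *
      (indicatorFourier y z.2 * conj (indicatorFourier y' z.2) *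
        ((|z.2| ^ (-2 * d₂) : ℝ) : ℂ)))) := by
    refine tendsto_integral_filter_of_dominated_convergence
      (fun z => C * (((x + Real.pi) * (x' + Real.pi) * decay d₁ z.1) *
        ((y + Real.pi) * (y' + Real.pi) * decay d₂ z.2))) ?_ ?_ ?_ ?_
    · filter_upwards [ha.eventually_gt_atTop 0, hb.eventually_gt_atTop 0] with n han hbn
      refine (aestronglyMeasurable_comp_div_prod han hbn ?_).const_mul _
      exact ((integrable_expSum_mul hint _ _ _ _).integrable_indicator
        measurableSet_freqSquare).aestronglyMeasurable
    · filter_upwards [ha.eventually_gt_atTop 0, hb.eventually_gt_atTop 0] with n han hbn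
      filter_upwards [hne] with z hz
      -- The origin belongs to the square, so `0 ≤ g(0,0) ≤ C`.
      have hCnn : 0 ≤ C := (hg_nonneg (0, 0) (by simp [freqSquare, hp.le])).trans
        (hC (0, 0) (by simp [freqSquare, hp.le]))
      have h1 := decay_nonneg d₁ z.1
      have h2 := decay_nonneg d₂ z.2
      by_cases hzm : (z.1 / a n, z.2 / b n) ∈ freqSquare
      · rw [hGeq n han hbn z hzm, norm_mul, norm_mul, mul_comm C, Complex.norm_real,
          Real.norm_of_nonneg (hg_nonneg _ hzm)]
        have hzm' := (hmem n z).1 hzm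
        gcongr
        · exact hg_nonneg _ hzm
        · exact norm_transfer_le han hx hx' hz.1 hzm'.1
        · exact norm_transfer_le hbn hy hy' hz.2 hzm'.2
        · exact hC _ hzm
      · simp only [hG, Set.indicator_of_notMem hzm, mul_zero, norm_zero]
        positivity
    · exact (((integrable_decay hd₁ hd₁').const_mul _).mul_prod
        ((integrable_decay hd₂ hd₂').const_mul _)).const_mul C
    · filter_upwards [hne] with z hz
      have hza : Tendsto (fun n => z.1 / a n) atTop (𝓝 0) := by
        simpa [div_eq_mul_inv] using (tendsto_inv_atTop_zero.comp ha).const_mul z.1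
      have hzb : Tendsto (fun n => z.2 / b n) atTop (𝓝 0) := by
        simpa [div_eq_mul_inv] using (tendsto_inv_atTop_zero.comp hb).const_mul z.2
      -- The limit of `g` is taken off the origin; a nonzero first coordinate keeps the rescaled
      -- point away from it.
      have hz0 : Tendsto (fun n => (z.1 / a n, z.2 / b n)) atTop (𝓝[≠] ((0 : ℝ), (0 : ℝ))) := by
        refine tendsto_nhdsWithin_iff.2 ⟨hza.prodMk_nhds hzb, ?_⟩
        filter_upwards [ha.eventually_gt_atTop 0] with n han h
        exact div_ne_zero hz.1 han.ne' (congrArg Prod.fst h)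
      have hgz := ((Complex.continuous_ofReal.tendsto 1).comp hg_lim).comp hz0
      have h := ((tendsto_transfer ha d₁ hx hx' hz.1).mul
        (tendsto_transfer hb d₂ hy hy' hz.2)).mul hgz
      rw [Complex.ofReal_one, mul_one] at h
      refine h.congr' ?_
      -- Each fixed frequency eventually lies in the dilated square, where the indicator is 1.
      have ha' := hza.abs.eventually_le_const (by simpa using hp : |(0 : ℝ)| < Real.pi)
      have hb' := hzb.abs.eventually_le_const (by simpa using hp : |(0 : ℝ)| < Real.pi)
      filter_upwards [ha.eventually_gt_atTop 0, hb.eventually_gt_atTop 0, ha', hb'] with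
        n han hbn h1 h2
      exact (hGeq n han hbn z ((hmem n z).2 ⟨h1, h2⟩)).symm
  rw [← integral_indicatorFourier_mul_conj hd₁ hd₁', ← integral_indicatorFourier_mul_conj hd₂ hd₂',
    ← integral_prod_mul]
  exact hlim.congr' (hint0.mono fun n h => h.symm)

/-! ### Gaussian vectors and processes -/

/-- Each such sum is a continuous linear image of finitely many coordinates of `X`. -/
theorem isGaussianProcess_sum {Ω T S ι : Type*} [MeasurableSpace Ω] {P : Measure Ω}
    {X : T → Ω → ℝ} (hX : IsGaussianProcess X P) (J : S → Finset ι) (c : S → ι → ℝ)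
    (τ : S → ι → T) :
    IsGaussianProcess (fun s ω => ∑ i ∈ J s, c s i * X (τ s i) ω) P := by
  classical
  refine hX.of_isGaussianProcess fun s => ⟨(J s).image (τ s),
    ∑ i ∈ (J s).attach, c s i • ContinuousLinearMap.proj (R := ℝ) (φ := fun _ => ℝ)
      (⟨τ s i, Finset.mem_image_of_mem _ i.2⟩ : (J s).image (τ s)), fun ω => ?_⟩
  rw [← Finset.sum_attach]
  simp

section Vectors

variable {ι Ω Ω' : Type*} [Fintype ι] [MeasurableSpace Ω] [MeasurableSpace Ω'] {P : Measure Ω}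
  {P' : Measure Ω'}

theorem charFun_map_toLp_of_hasGaussianLaw [IsProbabilityMeasure P] {X : ι → Ω → ℝ}
    (hX : HasGaussianLaw (fun ω i => X i ω) P) (h0 : ∀ i, ∫ ω, X i ω ∂P = 0)
    (t : EuclideanSpace ℝ ι) :
    charFun (P.map fun ω => WithLp.toLp 2 fun i => X i ω) t =
      Complex.exp (-((∑ i, ∑ j, t i * t j * cov[X i, X j; P] : ℝ) : ℂ) / 2) := by
  have hL := hX.toLp_pi 2
  rw [hL.charFun_map_eq t]
  have hin : (fun ω => inner ℝ t (WithLp.toLp 2 fun i => X i ω)) =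
      fun ω => ∑ i, t i * X i ω := by
    ext ω
    simp [PiLp.inner_apply, mul_comm]
  have hm : ∀ i, MemLp (fun ω => t i * X i ω) 2 P := fun i =>
    ((hX.eval i).memLp_two).const_mul (t i)
  have hmean : ∫ ω, ∑ i, t i * X i ω ∂P = 0 := by
    rw [integral_finsetSum _ fun i _ => (hm i).integrable one_le_two]
    simp [integral_const_mul, h0]
  have hvar : Var[fun ω => ∑ i, t i * X i ω; P] = ∑ i, ∑ j, t i * t j * cov[X i, X j; P] := by
    rw [← covariance_self (memLp_finsetSum _ fun i _ => hm i).aemeasurable,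
      covariance_fun_sum_fun_sum hm hm]
    refine Finset.sum_congr rfl fun i _ => Finset.sum_congr rfl fun j _ => ?_
    rw [covariance_const_mul_left, covariance_const_mul_right]
    ring
  rw [hin, hmean, hvar]
  congr 1
  push_cast
  ring

/-- Centred Gaussian vectors whose covariances converge to those of a centred Gaussian vector
converge in distribution. -/
theorem tendstoInDistribution_of_tendsto_covariance [IsProbabilityMeasure P]
    [IsProbabilityMeasure P'] {X : ℕ → ι → Ω → ℝ} {Z : ι → Ω' → ℝ}
    (hX : ∀ n, HasGaussianLaw (fun ω i => X n i ω) P) (hX0 : ∀ n i, ∫ ω, X n i ω ∂P = 0)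
    (hZ : HasGaussianLaw (fun ω i => Z i ω) P') (hZ0 : ∀ i, ∫ ω, Z i ω ∂P' = 0)
    (hcov : ∀ i j, Tendsto (fun n => cov[X n i, X n j; P]) atTop (𝓝 cov[Z i, Z j; P'])) :
    TendstoInDistribution (fun n ω i => X n i ω) atTop (fun ω i => Z i ω) (fun _ => P) P' := by
  -- Characteristic functions require an inner product, so the argument runs in `EuclideanSpace` and
  -- returns to the function space by the continuous map `WithLp.ofLp`.
  have h : TendstoInDistribution
      (fun n ω => (WithLp.toLp 2 fun i => X n i ω : EuclideanSpace ℝ ι)) atTop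
      (fun ω => (WithLp.toLp 2 fun i => Z i ω : EuclideanSpace ℝ ι)) (fun _ => P) P' := by
    refine ⟨fun n => ((hX n).toLp_pi 2).aemeasurable, (hZ.toLp_pi 2).aemeasurable, ?_⟩
    refine ProbabilityMeasure.tendsto_iff_tendsto_charFun.2 fun t => ?_
    simp only [ProbabilityMeasure.coe_mk]
    rw [charFun_map_toLp_of_hasGaussianLaw hZ hZ0]
    simp_rw [fun n => charFun_map_toLp_of_hasGaussianLaw (hX n) (hX0 n) t]
    refine (Complex.continuous_exp.tendsto _).comp (Tendsto.div_const (Tendsto.neg ?_) 2)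
    refine (Complex.continuous_ofReal.tendsto _).comp ?_
    exact tendsto_finsetSum _ fun i _ => tendsto_finsetSum _ fun j _ => (hcov i j).const_mul _
  exact h.continuous_comp (g := WithLp.ofLp) (PiLp.continuous_ofLp 2 _)

/-- Centred Gaussian vectors with the same covariances have the same law. -/
theorem identDistrib_of_covariance_eq [IsProbabilityMeasure P] [IsProbabilityMeasure P']
    {X : ι → Ω → ℝ} {Z : ι → Ω' → ℝ}
    (hX : HasGaussianLaw (fun ω i => X i ω) P) (hX0 : ∀ i, ∫ ω, X i ω ∂P = 0)
    (hZ : HasGaussianLaw (fun ω i => Z i ω) P') (hZ0 : ∀ i, ∫ ω, Z i ω ∂P' = 0)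
    (hcov : ∀ i j, cov[X i, X j; P] = cov[Z i, Z j; P']) :
    IdentDistrib (fun ω i => X i ω) (fun ω i => Z i ω) P P' := by
  have h : IdentDistrib (fun ω => WithLp.toLp 2 fun i => X i ω)
      (fun ω => WithLp.toLp 2 fun i => Z i ω) P P' := by
    have h1 := hX.toLp_pi 2
    have h2 := hZ.toLp_pi 2
    refine ⟨h1.aemeasurable, h2.aemeasurable, ?_⟩
    have := Measure.isProbabilityMeasure_map (μ := P) h1.aemeasurable
    have := Measure.isProbabilityMeasure_map (μ := P') h2.aemeasurable
    refine Measure.ext_of_charFun (funext fun t => ?_)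
    rw [charFun_map_toLp_of_hasGaussianLaw hX hX0, charFun_map_toLp_of_hasGaussianLaw hZ hZ0]
    simp_rw [hcov]
  exact h.comp (u := WithLp.ofLp) (by fun_prop)

end Vectors

/-! ### The isonormal Gaussian process of a Hilbert space -/

theorem integral_sq_eq_norm_sq {Ω : Type*} [MeasurableSpace Ω] {P : Measure Ω}
    (u : Lp ℝ 2 P) : ∫ ω, u ω * u ω ∂P = ‖u‖ ^ 2 := by
  rw [← real_inner_self_eq_norm_sq, L2.inner_def]
  rfl

theorem map_eq_gaussianReal_of_hasGaussianLaw {Ω : Type*} [MeasurableSpace Ω] {P : Measure Ω}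
    {u : Lp ℝ 2 P} (hu : HasGaussianLaw u P)
    (h0 : ∫ ω, u ω ∂P = 0) : P.map u = gaussianReal 0 (‖u‖₊ ^ 2) := by
  rw [hu.map_eq_gaussianReal, h0, variance_of_integral_eq_zero hu.aemeasurable h0]
  congr 1
  ext
  rw [Real.coe_toNNReal _ (integral_nonneg fun ω => by positivity)]
  simp only [sq, NNReal.coe_mul, coe_nnnorm]
  rw [← sq ‖u‖, ← integral_sq_eq_norm_sq]

section Isonormal

variable {Ω : Type*} [MeasurableSpace Ω] {P : Measure Ω} [IsProbabilityMeasure P]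

/-- Convergence in `L²` implies convergence in law, and the Gaussian characteristic function depends
continuously on the `L²` norm. -/
theorem isClosed_setOf_map_eq_gaussianReal :
    IsClosed {u : Lp ℝ 2 P | P.map u = gaussianReal 0 (‖u‖₊ ^ 2)} := by
  refine IsSeqClosed.isClosed fun u v hu huv => ?_
  have hd := (tendstoInMeasure_of_tendsto_Lp huv).tendstoInDistribution
    fun n => (Lp.aestronglyMeasurable (u n)).aemeasurable
  have hc := ProbabilityMeasure.tendsto_iff_tendsto_charFun.1 hd.tendsto
  simp only [ProbabilityMeasure.coe_mk] at hc
  have := Measure.isProbabilityMeasure_map (μ := P) (Lp.aestronglyMeasurable v).aemeasurable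
  refine Measure.ext_of_charFun (funext fun t => ?_)
  refine tendsto_nhds_unique (hc t) ?_
  have hn : Tendsto (fun n => ‖u n‖) atTop (𝓝 ‖v‖) := huv.norm
  have h1 : Tendsto (fun n => ((‖u n‖ ^ 2 : ℝ) : ℂ)) atTop (𝓝 ((‖v‖ ^ 2 : ℝ) : ℂ)) :=
    (Complex.continuous_ofReal.tendsto _).comp (hn.pow 2)
  have h2 := (Complex.continuous_exp.tendsto _).comp
    (((h1.mul_const ((t : ℂ) ^ 2)).div_const 2).const_sub ((t : ℂ) * (0 : ℝ) * Complex.I))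
  rw [charFun_gaussianReal]
  refine h2.congr fun n => ?_
  rw [show P.map (u n) = _ from hu n, charFun_gaussianReal]
  simp

/-- Send a Hilbert basis to independent standard Gaussian coordinates on a product space. These are
orthonormal in `L²`, so the map extends isometrically; finite combinations are Gaussian, and
closedness passes this to the limits. -/
theorem exists_isometry_gaussian (E : Type) [NormedAddCommGroup E] [InnerProductSpace ℝ E]
    [CompleteSpace E] :
    ∃ (Ω' : Type) (_ : MeasurableSpace Ω') (P' : Measure Ω') (_ : IsProbabilityMeasure P')
      (T : E →ₗᵢ[ℝ] Lp ℝ 2 P'), ∀ f, P'.map (T f) = gaussianReal 0 (‖T f‖₊ ^ 2) := by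
  obtain ⟨w, b, -⟩ := exists_hilbertBasis ℝ E
  let P' : Measure (w → ℝ) := Measure.infinitePi fun _ => gaussianReal 0 1
  have hlaw : ∀ i : w, HasLaw (fun ω : w → ℝ => ω i) (gaussianReal 0 1) P' := fun i =>
    (measurePreserving_eval_infinitePi (fun _ : w => gaussianReal 0 1) i).hasLaw
  have hG : ∀ i : w, HasGaussianLaw (fun ω : w → ℝ => ω i) P' := fun i => (hlaw i).hasGaussianLaw
  have hind : iIndepFun (fun (i : w) (ω : w → ℝ) => ω i) P' :=
    iIndepFun_infinitePi (X := fun _ x => x) fun _ => measurable_id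
  have hmean : ∀ i : w, ∫ ω : w → ℝ, ω i ∂P' = 0 := fun i => by
    rw [(hlaw i).integral_eq, integral_id_gaussianReal]
  have hmem : ∀ i : w, MemLp (fun ω : w → ℝ => ω i) 2 P' := fun i => (hG i).memLp_two
  have hproc : IsGaussianProcess (fun (i : w) (ω : w → ℝ) => ω i) P' :=
    ⟨fun I => iIndepFun.hasGaussianLaw (fun i => hG i)
      (hind.precomp (g := ((↑) : I → w)) Subtype.coe_injective)⟩
  let ξ : w → Lp ℝ 2 P' := fun i => (hmem i).toLp
  have hinner : ∀ i j, inner ℝ (ξ i) (ξ j) = cov[fun ω : w → ℝ => ω i, fun ω => ω j; P'] := by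
    intro i j
    rw [L2.inner_def, covariance, hmean, hmean]
    refine integral_congr_ae ?_
    filter_upwards [(hmem i).coeFn_toLp, (hmem j).coeFn_toLp] with ω h1 h2
    simp [ξ, h1, h2, mul_comm]
  have hξ : Orthonormal ℝ ξ := by
    classical
    rw [orthonormal_iff_ite]
    intro i j
    rw [hinner]
    split_ifs with hij
    · subst hij
      rw [covariance_self (hG i).aemeasurable, (hlaw i).variance_eq, variance_id_gaussianReal]
      rfl
    · exact (hind.indepFun hij).covariance_eq_zero (hmem i) (hmem j)
  have hV := hξ.orthogonalFamily
  refine ⟨w → ℝ, inferInstance, P', inferInstance,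
    hV.linearIsometry.comp b.repr.toLinearIsometry, fun f => ?_⟩
  have hsum := hV.hasSum_linearIsometry (b.repr f)
  refine isClosed_setOf_map_eq_gaussianReal.mem_of_tendsto hsum (Eventually.of_forall fun s => ?_)
  have hae : ((∑ i ∈ s, LinearIsometry.toSpanSingleton ℝ (Lp ℝ 2 P') (hξ.1 i) (b.repr f i) :
      Lp ℝ 2 P') : (w → ℝ) → ℝ) =ᵐ[P'] fun ω => ∑ i ∈ s, b.repr f i * ω i := by
    refine (Lp.coeFn_finsetSum s _).trans ?_
    have h : ∀ i ∈ s, ∀ᵐ ω ∂P', (LinearIsometry.toSpanSingleton ℝ (Lp ℝ 2 P') (hξ.1 i)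
        (b.repr f i) : Lp ℝ 2 P') ω = b.repr f i * ω i := by
      intro i _
      have h1 := Lp.coeFn_smul (b.repr f i) (ξ i)
      filter_upwards [h1, (hmem i).coeFn_toLp] with ω h1 h2
      rw [LinearIsometry.toSpanSingleton_apply, h1, Pi.smul_apply, h2, smul_eq_mul]
    filter_upwards [(Finset.eventually_all s).2 h] with ω hω
    rw [Finset.sum_apply]
    exact Finset.sum_congr rfl hω
  have hgs : HasGaussianLaw (fun ω : w → ℝ => ∑ i ∈ s, b.repr f i * ω i) P' :=
    (isGaussianProcess_sum hproc (S := Unit) (fun _ => s) (fun _ i => b.repr f i)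
      (fun _ i => i)).hasGaussianLaw_eval ()
  refine map_eq_gaussianReal_of_hasGaussianLaw (hgs.congr hae.symm) ?_
  rw [integral_congr_ae hae, integral_finsetSum _ fun i _ => ((hG i).integrable.const_mul _)]
  simp [integral_const_mul, hmean]

/-- Every Hilbert space carries an isonormal Gaussian process. -/
theorem exists_isonormal (E : Type) [NormedAddCommGroup E] [InnerProductSpace ℝ E]
    [CompleteSpace E] :
    ∃ (Ω' : Type) (_ : MeasurableSpace Ω') (P' : Measure Ω') (_ : IsProbabilityMeasure P')
      (W : E → Ω' → ℝ), IsGaussianProcess W P' ∧ (∀ f, ∫ ω, W f ω ∂P' = 0) ∧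
        ∀ f g, cov[W f, W g; P'] = inner ℝ f g := by
  obtain ⟨Ω', mΩ', P', hP', T, hT⟩ := exists_isometry_gaussian E
  have hlaw : ∀ f, HasLaw (T f) (gaussianReal 0 (‖T f‖₊ ^ 2)) P' := fun f =>
    ⟨(Lp.aestronglyMeasurable _).aemeasurable, hT f⟩
  have hG : ∀ f, HasGaussianLaw (T f) P' := fun f => (hlaw f).hasGaussianLaw
  have hmean : ∀ f, ∫ ω, T f ω ∂P' = 0 := fun f => by
    rw [(hlaw f).integral_eq, integral_id_gaussianReal]
  refine ⟨Ω', mΩ', P', hP', fun f => T f, ⟨fun I => ⟨?_⟩⟩, hmean, fun f g => ?_⟩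
  · have hmeas : AEMeasurable (fun ω => I.restrict fun f => T f ω) P' :=
      aemeasurable_pi_lambda _ fun f => (hG f).aemeasurable
    refine ⟨fun L => ?_⟩
    classical
    -- By linearity of `T`, any linear functional of finitely many `T f` is almost surely `T h` for
    -- a single vector `h`, so one-dimensional laws suffice for joint Gaussianity.
    set h : E := ∑ f : I, L (Pi.single f 1) • (f : E) with hh
    have hae : (L ∘ fun ω => I.restrict fun f => T f ω) =ᵐ[P'] T h := by
      have h1 : T h = ∑ f : I, L (Pi.single f 1) • T (f : E) := by
        rw [hh, map_sum]
        simp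
      rw [h1]
      refine EventuallyEq.symm ((Lp.coeFn_finsetSum _ _).trans ?_)
      have h2 : ∀ f : I, ∀ᵐ ω ∂P', (L (Pi.single f 1) • T (f : E) : Lp ℝ 2 P') ω =
          L (Pi.single f 1) * T (f : E) ω := fun f => Lp.coeFn_smul _ _
      filter_upwards [ae_all_iff.2 h2] with ω hω
      rw [Finset.sum_apply, Finset.sum_congr rfl fun f _ => hω f, Function.comp]
      refine Eq.trans ?_ (LinearMap.pi_apply_eq_sum_univ (L : (I → ℝ) →ₗ[ℝ] ℝ) _).symm
      refine Finset.sum_congr rfl fun f _ => ?_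
      rw [smul_eq_mul, mul_comm]
      have h3 : (Pi.single f 1 : I → ℝ) = fun j => if f = j then 1 else 0 := by
        ext j
        simp [Pi.single_apply, eq_comm]
      rw [h3]
      rfl
    have hGL := ((hG h).congr hae.symm).map_eq_gaussianReal
    rw [AEMeasurable.map_map_of_aemeasurable L.continuous.measurable.aemeasurable hmeas, hGL,
      integral_map hmeas L.continuous.aestronglyMeasurable,
      variance_map L.continuous.measurable.aemeasurable hmeas]
    rfl
  · rw [← T.inner_map_map, L2.inner_def, covariance, hmean, hmean]
    refine integral_congr_ae (ae_of_all _ fun ω => ?_)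
    simp [mul_comm]

end Isonormal

/-! ### Existence of the fractional Brownian sheet -/

section Sheet

/-- The spectral representation of the fractional Brownian sheet. -/
noncomputable def sheetKernel (d₁ d₂ : ℝ) (p : ℝ≥0 × ℝ≥0) (z : ℝ × ℝ) : ℂ :=
  (((kappa d₁ * kappa d₂)⁻¹ : ℝ) : ℂ) *
    ((indicatorFourier p.1 z.1 * ((|z.1| ^ (-d₁) : ℝ) : ℂ)) *
      (indicatorFourier p.2 z.2 * ((|z.2| ^ (-d₂) : ℝ) : ℂ)))

theorem measurable_sheetKernel (d₁ d₂ : ℝ) (p : ℝ≥0 × ℝ≥0) :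
    Measurable (sheetKernel d₁ d₂ p) := by
  have h1 : Measurable fun z : ℝ × ℝ => indicatorFourier p.1 z.1 :=
    (measurable_indicatorFourier p.1).comp measurable_fst
  have h2 : Measurable fun z : ℝ × ℝ => indicatorFourier p.2 z.2 :=
    (measurable_indicatorFourier p.2).comp measurable_snd
  exact ((h1.mul (by fun_prop)).mul (h2.mul (by fun_prop))).const_mul _

theorem rpow_neg_mul_self {s : ℝ} (hs : 0 ≤ s) (d : ℝ) : s ^ (-d) * s ^ (-d) = s ^ (-2 * d) := by
  rw [← sq, ← Real.rpow_mul_natCast hs]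
  congr 1
  push_cast
  ring

theorem sheetKernel_mul_conj (d₁ d₂ : ℝ) (p q : ℝ≥0 × ℝ≥0) (z : ℝ × ℝ) :
    sheetKernel d₁ d₂ p z * conj (sheetKernel d₁ d₂ q z) =
      (((kappa d₁ * kappa d₂)⁻¹ ^ 2 : ℝ) : ℂ) *
      ((indicatorFourier p.1 z.1 * conj (indicatorFourier q.1 z.1) *
          ((|z.1| ^ (-2 * d₁) : ℝ) : ℂ)) *
        (indicatorFourier p.2 z.2 * conj (indicatorFourier q.2 z.2) *
          ((|z.2| ^ (-2 * d₂) : ℝ) : ℂ))) := by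
  rw [← rpow_neg_mul_self (abs_nonneg z.1), ← rpow_neg_mul_self (abs_nonneg z.2)]
  simp only [sheetKernel, map_mul, Complex.conj_ofReal, Complex.ofReal_mul, Complex.ofReal_pow]
  ring

variable {d₁ d₂ : ℝ}

theorem integrable_sheetKernel_mul_conj (hd₁ : 0 < d₁) (hd₁' : d₁ < 1 / 2) (hd₂ : 0 < d₂)
    (hd₂' : d₂ < 1 / 2) (p q : ℝ≥0 × ℝ≥0) :
    Integrable fun z => sheetKernel d₁ d₂ p z * conj (sheetKernel d₁ d₂ q z) := by
  simp_rw [sheetKernel_mul_conj]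
  exact ((integrable_indicatorFourier_mul_conj hd₁ hd₁' p.1 q.1).mul_prod
    (integrable_indicatorFourier_mul_conj hd₂ hd₂' p.2 q.2)).const_mul _

theorem memLp_sheetKernel (hd₁ : 0 < d₁) (hd₁' : d₁ < 1 / 2) (hd₂ : 0 < d₂)
    (hd₂' : d₂ < 1 / 2) (p : ℝ≥0 × ℝ≥0) : MemLp (sheetKernel d₁ d₂ p) 2 := by
  rw [memLp_two_iff_integrable_sq_norm (measurable_sheetKernel d₁ d₂ p).aestronglyMeasurable]
  refine (integrable_sheetKernel_mul_conj hd₁ hd₁' hd₂ hd₂' p p).norm.congr (ae_of_all _ fun z => ?_)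
  simp only [norm_mul, Complex.norm_conj, sq]

theorem integral_sheetKernel_mul_conj (hd₁ : 0 < d₁) (hd₁' : d₁ < 1 / 2) (hd₂ : 0 < d₂)
    (hd₂' : d₂ < 1 / 2) (p q : ℝ≥0 × ℝ≥0) :
    ∫ z, sheetKernel d₁ d₂ p z * conj (sheetKernel d₁ d₂ q z) =
      (((1 / 4 : ℝ) * ((p.1 : ℝ) ^ (2 * (d₁ + 1 / 2)) + (q.1 : ℝ) ^ (2 * (d₁ + 1 / 2))
          - |(p.1 : ℝ) - (q.1 : ℝ)| ^ (2 * (d₁ + 1 / 2))) *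
        ((p.2 : ℝ) ^ (2 * (d₂ + 1 / 2)) + (q.2 : ℝ) ^ (2 * (d₂ + 1 / 2))
          - |(p.2 : ℝ) - (q.2 : ℝ)| ^ (2 * (d₂ + 1 / 2))) : ℝ) : ℂ) := by
  simp_rw [sheetKernel_mul_conj]
  rw [integral_const_mul]
  have h := integral_prod_mul (μ := (volume : Measure ℝ)) (ν := (volume : Measure ℝ))
    (fun s => indicatorFourier p.1 s * conj (indicatorFourier q.1 s) *
      ((|s| ^ (-2 * d₁) : ℝ) : ℂ))
    (fun s => indicatorFourier p.2 s * conj (indicatorFourier q.2 s) *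
      ((|s| ^ (-2 * d₂) : ℝ) : ℂ))
  rw [← Measure.volume_eq_prod] at h
  rw [h, integral_indicatorFourier_mul_conj hd₁ hd₁', integral_indicatorFourier_mul_conj hd₂ hd₂',
    ← Complex.ofReal_mul, ← Complex.ofReal_mul]
  congr 1
  simp only [NNReal.abs_eq]
  have h1 := (kappa_pos hd₁ hd₁').ne'
  have h2 := (kappa_pos hd₂ hd₂').ne'
  field_simp
  ring

/-- The sheet is the isonormal process over complex `L²(ℝ²)`, viewed as a real Hilbert space,
evaluated at the spectral kernels. The real inner product is the real part of the Hermitian one,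
here already real. -/
theorem exists_isFractionalBrownianSheet (hd₁ : 0 < d₁) (hd₁' : d₁ < 1 / 2) (hd₂ : 0 < d₂)
    (hd₂' : d₂ < 1 / 2) :
    ∃ (Ω' : Type) (_ : MeasurableSpace Ω') (P' : Measure Ω') (_ : IsProbabilityMeasure P')
      (B : ℝ≥0 × ℝ≥0 → Ω' → ℝ),
      IsFractionalBrownianSheet (d₁ + 1 / 2) (d₂ + 1 / 2) B P' := by
  obtain ⟨Ω', mΩ', P', hP', W, hW, hW0, hWcov⟩ :=
    exists_isonormal (Lp ℂ 2 (volume : Measure (ℝ × ℝ)))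
  have hm := memLp_sheetKernel hd₁ hd₁' hd₂ hd₂'
  refine ⟨Ω', mΩ', P', hP', fun p => W ((hm p).toLp), ?_, fun p => hW0 _, fun p q => ?_⟩
  · exact hW.comp_right fun p => (hm p).toLp
  · have hint := integrable_sheetKernel_mul_conj hd₁ hd₁' hd₂ hd₂' p q
    have h := congrArg Complex.re (integral_sheetKernel_mul_conj hd₁ hd₁' hd₂ hd₂' p q)
    have hre : (∫ z, sheetKernel d₁ d₂ p z * conj (sheetKernel d₁ d₂ q z)).re =
        ∫ z, (sheetKernel d₁ d₂ p z * conj (sheetKernel d₁ d₂ q z)).re := (integral_re hint).symm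
    rw [hre, Complex.ofReal_re] at h
    rw [← h, hWcov, L2.inner_def]
    refine integral_congr_ae ?_
    filter_upwards [(hm p).coeFn_toLp, (hm q).coeFn_toLp] with z h1 h2
    rw [h1, h2, Complex.inner]
    simp
    ring

end Sheet

/-! ### Rectangular increments of product-type Gaussian fields -/

/-- Twice the covariance of the increments over `(u, x]` and `(u', x']` of a fractional Brownian
motion with Hurst parameter `H`. -/
noncomputable def incrCov (H u x u' x' : ℝ) : ℝ :=
  |x - u'| ^ (2 * H) + |u - x'| ^ (2 * H) - |x - x'| ^ (2 * H) - |u - u'| ^ (2 * H)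

/-- A centred Gaussian field on the quadrant whose covariance is a multiple of that of a fractional
Brownian sheet. -/
structure IsScaledSheet {Ω : Type*} [MeasurableSpace Ω] (k H₁ H₂ : ℝ)
    (V : ℝ≥0 × ℝ≥0 → Ω → ℝ) (P : Measure Ω) : Prop where
  gaussian : IsGaussianProcess V P
  mean_zero : ∀ p, ∫ ω, V p ω ∂P = 0
  cov_eq : ∀ p q : ℝ≥0 × ℝ≥0, cov[V p, V q; P] =
    k * ((p.1 : ℝ) ^ (2 * H₁) + (q.1 : ℝ) ^ (2 * H₁) - |(p.1 : ℝ) - (q.1 : ℝ)| ^ (2 * H₁)) *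
      ((p.2 : ℝ) ^ (2 * H₂) + (q.2 : ℝ) ^ (2 * H₂) - |(p.2 : ℝ) - (q.2 : ℝ)| ^ (2 * H₂))

theorem rectIncr_eq_sum {Ω : Type*} (V : ℝ≥0 × ℝ≥0 → Ω → ℝ) (u v x y : ℝ≥0) (ω : Ω) :
    rectIncr V u v x y ω = ∑ i : Fin 4, (![1, -1, -1, 1] : Fin 4 → ℝ) i *
      V ((![(x, y), (u, y), (x, v), (u, v)] : Fin 4 → ℝ≥0 × ℝ≥0) i) ω := by
  simp [rectIncr, Fin.sum_univ_four]
  ring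

namespace IsScaledSheet

variable {Ω : Type*} [MeasurableSpace Ω] {P : Measure Ω} {k H₁ H₂ : ℝ}
  {V : ℝ≥0 × ℝ≥0 → Ω → ℝ}

theorem isGaussianProcess_rectIncr (hV : IsScaledSheet k H₁ H₂ V P) {S : Type*}
    (u v x y : S → ℝ≥0) :
    IsGaussianProcess (fun s => rectIncr V (u s) (v s) (x s) (y s)) P := by
  have h := isGaussianProcess_sum hV.gaussian (fun _ : S => (Finset.univ : Finset (Fin 4)))
    (fun _ => ![1, -1, -1, 1])
    (fun s => ![(x s, y s), (u s, y s), (x s, v s), (u s, v s)])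
  simp_rw [← rectIncr_eq_sum] at h
  exact h

theorem hasGaussianLaw_rectIncr (hV : IsScaledSheet k H₁ H₂ V P) (u v x y : ℝ≥0) :
    HasGaussianLaw (rectIncr V u v x y) P :=
  (hV.isGaussianProcess_rectIncr (S := Unit) (fun _ => u) (fun _ => v) (fun _ => x)
    (fun _ => y)).hasGaussianLaw_eval ()

theorem integral_rectIncr (hV : IsScaledSheet k H₁ H₂ V P) (u v x y : ℝ≥0) :
    ∫ ω, rectIncr V u v x y ω ∂P = 0 := by
  have hi : ∀ p, Integrable (V p) P := fun p => (hV.gaussian.hasGaussianLaw_eval p).integrable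
  simp_rw [rectIncr_eq_sum]
  rw [integral_finsetSum _ fun i _ => (hi _).const_mul _]
  simp [integral_const_mul, hV.mean_zero]

variable [IsProbabilityMeasure P]

/-- The four-corner difference of a product covariance factors by coordinate, and the terms
depending on one endpoint alone cancel in each factor. -/
theorem covariance_rectIncr (hV : IsScaledSheet k H₁ H₂ V P) (u v x y u' v' x' y' : ℝ≥0) :
    cov[rectIncr V u v x y, rectIncr V u' v' x' y'; P] =
      k * incrCov H₁ u x u' x' * incrCov H₂ v y v' y' := by
  have hm : ∀ p, MemLp (V p) 2 P := fun p => (hV.gaussian.hasGaussianLaw_eval p).memLp_two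
  rw [show rectIncr V u v x y = _ from funext (rectIncr_eq_sum V u v x y),
    show rectIncr V u' v' x' y' = _ from funext (rectIncr_eq_sum V u' v' x' y'),
    covariance_fun_sum_fun_sum (fun i => (hm _).const_mul _) (fun i => (hm _).const_mul _)]
  simp_rw [covariance_const_mul_left, covariance_const_mul_right, hV.cov_eq]
  set R₁ : ℝ≥0 → ℝ≥0 → ℝ := fun p q =>
    (p : ℝ) ^ (2 * H₁) + (q : ℝ) ^ (2 * H₁) - |(p : ℝ) - (q : ℝ)| ^ (2 * H₁) with hR₁
  set R₂ : ℝ≥0 → ℝ≥0 → ℝ := fun p q =>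
    (p : ℝ) ^ (2 * H₂) + (q : ℝ) ^ (2 * H₂) - |(p : ℝ) - (q : ℝ)| ^ (2 * H₂) with hR₂
  have h1 : incrCov H₁ u x u' x' = R₁ x x' - R₁ x u' - R₁ u x' + R₁ u u' := by
    simp only [incrCov, hR₁]
    ring
  have h2 : incrCov H₂ v y v' y' = R₂ y y' - R₂ y v' - R₂ v y' + R₂ v v' := by
    simp only [incrCov, hR₂]
    ring
  change ∑ i : Fin 4, ∑ j : Fin 4, _ * (_ * (k * R₁ _ _ * R₂ _ _)) = _
  rw [h1, h2]
  simp only [Fin.sum_univ_four, Matrix.cons_val]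
  ring

/-- `incrCov` involves only differences of endpoints, so shifting both rectangles leaves all
covariances unchanged. -/
theorem hasStationaryRectIncr (hV : IsScaledSheet k H₁ H₂ V P) : HasStationaryRectIncr V P := by
  intro u v _ _ I
  refine identDistrib_of_covariance_eq
    ((hV.isGaussianProcess_rectIncr (S := ℝ≥0 × ℝ≥0) (fun _ => u) (fun _ => v)
      (fun p => u + p.1) (fun p => v + p.2)).hasGaussianLaw I)
    (fun i => hV.integral_rectIncr _ _ _ _)
    ((hV.isGaussianProcess_rectIncr (S := ℝ≥0 × ℝ≥0) (fun _ => 0) (fun _ => 0)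
      (fun p => p.1) (fun p => p.2)).hasGaussianLaw I)
    (fun i => hV.integral_rectIncr _ _ _ _) fun i j => ?_
  refine (hV.covariance_rectIncr _ _ _ _ _ _ _ _).trans
    (Eq.trans ?_ (hV.covariance_rectIncr _ _ _ _ _ _ _ _).symm)
  simp [incrCov]

theorem ae_eq_zero_of_variance (hV : IsScaledSheet k H₁ H₂ V P) {p : ℝ≥0 × ℝ≥0}
    (h : cov[V p, V p; P] = 0) : V p =ᵐ[P] 0 := by
  have hG := hV.gaussian.hasGaussianLaw_eval p
  rw [covariance_self hG.aemeasurable] at h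
  filter_upwards [ae_eq_integral_of_variance_eq_zero hG.memLp_two h] with ω hω
  rw [hω, hV.mean_zero]
  rfl

end IsScaledSheet

/-! ### Neither independence nor invariance in any direction -/

theorem two_lt_two_rpow {H : ℝ} (hH : 1 / 2 < H) : (2 : ℝ) < 2 ^ (2 * H) := by
  conv_lhs => rw [← Real.rpow_one 2]
  exact Real.rpow_lt_rpow_of_exponent_lt one_lt_two (by linarith)

theorem two_rpow_lt_four {H : ℝ} (hH : H < 1) : (2 : ℝ) ^ (2 * H) < 4 := by
  rw [show (4 : ℝ) = 2 ^ (2 : ℝ) by norm_num]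
  exact Real.rpow_lt_rpow_of_exponent_lt one_lt_two (by linarith)

/-- For every `z` there is an interval whose fractional Brownian increment is positively correlated
with that of its translate by `z`, but strictly less than with itself if `z ≠ 0`. -/
theorem exists_interval_translate {H : ℝ} (hH : 1 / 2 < H) (hH' : H < 1) (z : ℝ) :
    ∃ u x u' x' : ℝ≥0, u < x ∧ u' < x' ∧ (u' : ℝ) = z + u ∧ (x' : ℝ) = z + x ∧
      0 < incrCov H u x u' x' ∧ incrCov H u x u' x' ≤ incrCov H u x u x ∧
      (z ≠ 0 → incrCov H u x u' x' < incrCov H u x u x) := by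
  have h2 := two_lt_two_rpow hH
  have h4 := two_rpow_lt_four hH'
  have h0 : (2 * H) ≠ 0 := by linarith
  -- For `z ≠ 0` take an interval of length `r = |z|`, so that its translate is adjacent to it. Then
  -- `incrCov` equals `(2^{2H} - 2) r^{2H}`, positive for `H > 1/2` and below the self-term `2
  -- r^{2H}` for `H < 1`.
  rcases lt_trichotomy z 0 with hz | rfl | hz
  · lift -z to ℝ≥0 using (by linarith) with r hr
    obtain rfl : z = -r := by linarith
    have hr0 : (0 : ℝ) < r := by linarith
    have hpos : 0 < (r : ℝ) ^ (2 * H) := Real.rpow_pos_of_pos hr0 _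
    refine ⟨r, 2 * r, 0, r, ?_, by exact_mod_cast hr0, by simp, by push_cast; ring, ?_⟩
    · rw [← NNReal.coe_lt_coe]
      push_cast
      linarith
    · simp only [incrCov, NNReal.coe_mul, NNReal.coe_ofNat, NNReal.coe_zero, sub_self, sub_zero,
        abs_zero, Real.zero_rpow h0, show (2 : ℝ) * r - r = r by ring,
        show (r : ℝ) - 2 * r = -r by ring, abs_neg, abs_mul, abs_two, NNReal.abs_eq,
        Real.mul_rpow zero_le_two r.coe_nonneg]
      refine ⟨by nlinarith, by nlinarith, fun _ => by nlinarith⟩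
  · refine ⟨0, 1, 0, 1, one_pos, one_pos, by simp, by simp, ?_, le_rfl, fun h => absurd rfl h⟩
    simp [incrCov, Real.zero_rpow h0]
  · lift z to ℝ≥0 using hz.le
    have hpos : 0 < (z : ℝ) ^ (2 * H) := Real.rpow_pos_of_pos hz _
    refine ⟨0, z, z, 2 * z, by exact_mod_cast hz, ?_, by simp, by push_cast; ring, ?_⟩
    · rw [← NNReal.coe_lt_coe]
      push_cast
      linarith
    · simp only [incrCov, NNReal.coe_mul, NNReal.coe_ofNat, NNReal.coe_zero, sub_self, sub_zero,
        abs_zero, Real.zero_rpow h0, zero_sub,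
        show (z : ℝ) - 2 * z = -z by ring, abs_neg, abs_mul, abs_two, NNReal.abs_eq,
        Real.mul_rpow zero_le_two z.coe_nonneg]
      refine ⟨by nlinarith, by nlinarith, fun _ => by nlinarith⟩

/-- For every slope `a` there are two intervals with positively correlated fractional Brownian
increments, on which `s ↦ a * s` is at most, respectively at least, `a`. -/
theorem exists_separated_pair {H : ℝ} (hH : 1 / 2 < H) (a : ℝ) :
    ∃ u x u' x' : ℝ≥0, u < x ∧ u' < x' ∧ 0 < incrCov H u x u' x' ∧
      (∀ s : ℝ, s ∈ Set.Ioc (u : ℝ) x → a * s ≤ a) ∧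
      (∀ s : ℝ, s ∈ Set.Ioc (u' : ℝ) x' → a ≤ a * s) := by
  have h2 := two_lt_two_rpow hH
  have h0 : (2 * H) ≠ 0 := by linarith
  -- The intervals `(0,1]` and `(1,2]` meet at 1, where `a * s = a`; the sign of `a` decides which
  -- comes first.
  rcases le_total 0 a with ha | ha
  · refine ⟨0, 1, 1, 2, one_pos, one_lt_two, ?_, fun s hs => ?_, fun s hs => ?_⟩
    · simp only [incrCov, NNReal.coe_zero, NNReal.coe_one, NNReal.coe_ofNat]
      norm_num [Real.zero_rpow h0]
      linarith
    · have := hs.2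
      simp only [NNReal.coe_one] at this
      nlinarith
    · have := hs.1
      simp only [NNReal.coe_one] at this
      nlinarith
  · refine ⟨1, 2, 0, 1, one_lt_two, one_pos, ?_, fun s hs => ?_, fun s hs => ?_⟩
    · simp only [incrCov, NNReal.coe_zero, NNReal.coe_one, NNReal.coe_ofNat]
      norm_num [Real.zero_rpow h0]
      linarith
    · have := hs.1
      simp only [NNReal.coe_one] at this
      nlinarith
    · have := hs.2
      simp only [NNReal.coe_one] at this
      nlinarith

namespace IsScaledSheet

variable {Ω : Type*} [MeasurableSpace Ω] {P : Measure Ω} [IsProbabilityMeasure P] {k H₁ H₂ : ℝ}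
  {V : ℝ≥0 × ℝ≥0 → Ω → ℝ}

/-- A line orthogonal to `ℓ` has normal `(-b, a)`. Choosing unit intervals in each coordinate gives
two squares on opposite sides of the orthogonal line through `(1, 1)` whose increments have positive
covariance. -/
theorem not_hasIndepRectIncr (hV : IsScaledSheet k H₁ H₂ V P) (hk : 0 < k) (hH₁ : 1 / 2 < H₁)
    (hH₂ : 1 / 2 < H₂) {a b : ℝ} (hab : (a, b) ≠ 0) : ¬ HasIndepRectIncr V P a b := by
  intro h
  obtain ⟨u, x, u', x', hux, hux', hpos₁, hl₁, hr₁⟩ := exists_separated_pair hH₁ (-b)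
  obtain ⟨v, y, v', y', hvy, hvy', hpos₂, hl₂, hr₂⟩ := exists_separated_pair hH₂ a
  have hne : (-b, a) ≠ 0 := by
    intro h0
    simp only [Prod.mk_eq_zero, neg_eq_zero] at h0
    exact hab (Prod.ext h0.2 h0.1)
  have hi := h (-b) a (-b + a) hne (by ring) ⟨u, v, x, y, hux, hvy⟩ ⟨u', v', x', y', hux', hvy'⟩
    (Or.inl ⟨fun p hp => add_le_add (hl₁ _ hp.1) (hl₂ _ hp.2),
      fun p hp => add_le_add (hr₁ _ hp.1) (hr₂ _ hp.2)⟩)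
  have hc := hi.covariance_eq_zero (hV.hasGaussianLaw_rectIncr _ _ _ _).memLp_two
    (hV.hasGaussianLaw_rectIncr _ _ _ _).memLp_two
  have hc' := hV.covariance_rectIncr u v x y u' v' x' y'
  have : 0 < k * incrCov H₁ u x u' x' * incrCov H₂ v y v' y' := by positivity
  exact this.ne' (hc'.symm.trans hc)

/-- Translation by `(-b, a)`, which lies on `ℓ`, would force the covariance of `V(K)` and `V(K')` to
equal the variance of `V(K)`. -/
theorem not_hasInvariantRectIncr (hV : IsScaledSheet k H₁ H₂ V P) (hk : 0 < k)
    (hH₁ : 1 / 2 < H₁) (hH₁' : H₁ < 1) (hH₂ : 1 / 2 < H₂) (hH₂' : H₂ < 1) {a b : ℝ}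
    (hab : (a, b) ≠ 0) : ¬ HasInvariantRectIncr V P a b := by
  intro h
  obtain ⟨u, x, u', x', hux, hux', hu, hx, hpos₁, hle₁, hlt₁⟩ :=
    exists_interval_translate hH₁ hH₁' (-b)
  obtain ⟨v, y, v', y', hvy, hvy', hv, hy, hpos₂, hle₂, hlt₂⟩ :=
    exists_interval_translate hH₂ hH₂' a
  have hset : (⟨u', v', x', y', hux', hvy'⟩ : Rect).toSet =
      (fun p : ℝ × ℝ => (-b, a) + p) '' (⟨u, v, x, y, hux, hvy⟩ : Rect).toSet := by
    simp only [Rect.toSet, hu, hv, hx, hy]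
    rw [← Set.image_const_add_Ioc, ← Set.image_const_add_Ioc, Set.prod_image_image_eq]
    rfl
  have he := h ⟨u, v, x, y, hux, hvy⟩ ⟨u', v', x', y', hux', hvy'⟩ (-b) a (by ring) hset
  have h1 := hV.covariance_rectIncr u v x y u v x y
  have h2 := hV.covariance_rectIncr u v x y u' v' x' y'
  have h3 : cov[rectIncr V u v x y, rectIncr V u v x y; P] =
      cov[rectIncr V u v x y, rectIncr V u' v' x' y'; P] := by
    simp only [covariance, hV.integral_rectIncr]
    refine integral_congr_ae ?_
    filter_upwards [he] with ω hω
    simp only [Rect.incr] at hω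
    rw [hω]
  rw [h1, h2, mul_assoc, mul_assoc] at h3
  have h4 := mul_left_cancel₀ hk.ne' h3
  refine absurd h4 (ne_of_gt ?_)
  -- At least one coordinate of the translation is nonzero and gives a strict inequality; positivity
  -- of both factors carries it to the product.
  by_cases hb : -b = 0
  · have ha : a ≠ 0 := fun ha => hab (Prod.ext ha (neg_eq_zero.1 hb))
    exact mul_lt_mul' hle₁ (hlt₂ ha) hpos₂.le (hpos₁.trans_le hle₁)
  · exact mul_lt_mul (hlt₁ hb) hle₂ hpos₂ (hpos₁.trans_le hle₁).le

theorem hasDependentRectIncr (hV : IsScaledSheet k H₁ H₂ V P) (hk : 0 < k)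
    (hH₁ : 1 / 2 < H₁) (hH₁' : H₁ < 1) (hH₂ : 1 / 2 < H₂) (hH₂' : H₂ < 1) :
    HasDependentRectIncr V P where
  aemeasurable := hV.gaussian.aemeasurable
  stationary := hV.hasStationaryRectIncr
  zero_right x := hV.ae_eq_zero_of_variance (by
    rw [hV.cov_eq]
    simp [Real.zero_rpow (show 2 * H₂ ≠ 0 by linarith)])
  zero_left y := hV.ae_eq_zero_of_variance (by
    rw [hV.cov_eq]
    simp [Real.zero_rpow (show 2 * H₁ ≠ 0 by linarith)])
  dependent _ _ hab := ⟨hV.not_hasIndepRectIncr hk hH₁ hH₂ hab,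
    hV.not_hasInvariantRectIncr hk hH₁ hH₁' hH₂ hH₂' hab⟩

end IsScaledSheet

theorem IsFractionalBrownianSheet.isScaledSheet {Ω : Type*} [MeasurableSpace Ω] {P : Measure Ω}
    {H₁ H₂ : ℝ} {B : ℝ≥0 × ℝ≥0 → Ω → ℝ} (hB : IsFractionalBrownianSheet H₁ H₂ B P) (c : ℝ) :
    IsScaledSheet (c ^ 2 * (1 / 4)) H₁ H₂ (fun p ω => c * B p ω) P where
  gaussian := hB.gaussian.smul fun _ => c
  mean_zero p := by rw [integral_const_mul, hB.mean_zero, mul_zero]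
  cov_eq p q := by
    rw [covariance_const_mul_left, covariance_const_mul_right, hB.cov_eq]
    ring

/-! ### The scaling limit -/

/-- The origin of `H(γ)`: twice it is `(1 + 2d₁) + γ(1 + 2d₂)`, the sum of the variance exponents
along the two sides of the box. -/
theorem rpow_neg_exponent_sq {γ d₁ d₂ : ℝ} {n : ℕ} (hn : 0 < n) :
    (n : ℝ) ^ (-((1 + γ) / 2 + d₁ + d₂ * γ)) * (n : ℝ) ^ (-((1 + γ) / 2 + d₁ + d₂ * γ)) =
      (n : ℝ) ^ (-1 - 2 * d₁) * ((n : ℝ) ^ γ) ^ (-1 - 2 * d₂) := by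
  have hn' : (0 : ℝ) < n := by exact_mod_cast hn
  rw [← Real.rpow_mul hn'.le, ← Real.rpow_add hn', ← Real.rpow_add hn']
  congr 1
  ring

section Limit

variable {Ω : Type*} [MeasurableSpace Ω] {P : Measure Ω} [IsProbabilityMeasure P]
  {Y : ℤ × ℤ → Ω → ℝ} {d₁ d₂ : ℝ} {g : ℝ × ℝ → ℝ}

/-- The specialization `a = n`, `b = n^γ`; `γ > 0` is what makes the second side diverge. -/
theorem tendsto_covariance_partialSum
    (hd₁ : 0 < d₁) (hd₁' : d₁ < 1 / 2) (hd₂ : 0 < d₂) (hd₂' : d₂ < 1 / 2)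
    (hg_nonneg : ∀ z ∈ freqSquare, 0 ≤ g z)
    (hg_bdd : ∃ C : ℝ, ∀ z ∈ freqSquare, g z ≤ C)
    (hg_lim : Tendsto g (𝓝[≠] (0, 0)) (𝓝 1))
    (hY : ∀ t, MemLp (Y t) 2 P)
    (hY_spec : IsSpectralDensity Y P (fun z => g z / (|z.1| ^ (2 * d₁) * |z.2| ^ (2 * d₂))))
    {γ : ℝ} (hγ : 0 < γ) (p q : ℝ≥0 × ℝ≥0) :
    Tendsto (fun n : ℕ => cov[fun ω => (n : ℝ) ^ (-((1 + γ) / 2 + d₁ + d₂ * γ)) *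
        partialSum Y γ n p.1 p.2 ω, fun ω => (n : ℝ) ^ (-((1 + γ) / 2 + d₁ + d₂ * γ)) *
        partialSum Y γ n q.1 q.2 ω; P]) atTop
      (𝓝 ((kappa d₁ * kappa d₂) ^ 2 * (1 / 4) *
        ((p.1 : ℝ) ^ (2 * (d₁ + 1 / 2)) + (q.1 : ℝ) ^ (2 * (d₁ + 1 / 2))
          - |(p.1 : ℝ) - (q.1 : ℝ)| ^ (2 * (d₁ + 1 / 2))) *
        ((p.2 : ℝ) ^ (2 * (d₂ + 1 / 2)) + (q.2 : ℝ) ^ (2 * (d₂ + 1 / 2))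
          - |(p.2 : ℝ) - (q.2 : ℝ)| ^ (2 * (d₂ + 1 / 2))))) := by
  have ha : Tendsto (fun n : ℕ => (n : ℝ)) atTop atTop := tendsto_natCast_atTop_atTop
  have hb : Tendsto (fun n : ℕ => (n : ℝ) ^ γ) atTop atTop := (tendsto_rpow_atTop hγ).comp ha
  have h := tendsto_integral_expSum hd₁ hd₁' hd₂ hd₂' hg_nonneg hg_bdd hg_lim hY_spec.integrable
    ha hb p.1.coe_nonneg q.1.coe_nonneg p.2.coe_nonneg q.2.coe_nonneg
  simp_rw [← covariance_sum_box hY hY_spec, ← Complex.ofReal_mul] at h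
  have h' := (Complex.continuous_re.tendsto _).comp h
  simp only [Complex.ofReal_re, NNReal.abs_eq] at h'
  convert h'.congr' ?_ using 2
  · ring
  · filter_upwards [eventually_gt_atTop 0] with n hn
    rw [covariance_const_mul_left, covariance_const_mul_right, ← mul_assoc,
      rpow_neg_exponent_sq hn]
    rfl

theorem scalingLimit_partialSum
    (hd₁ : 0 < d₁) (hd₁' : d₁ < 1 / 2) (hd₂ : 0 < d₂) (hd₂' : d₂ < 1 / 2)
    (hg_nonneg : ∀ z ∈ freqSquare, 0 ≤ g z)
    (hg_bdd : ∃ C : ℝ, ∀ z ∈ freqSquare, g z ≤ C)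
    (hg_lim : Tendsto g (𝓝[≠] (0, 0)) (𝓝 1))
    (hY_gauss : IsGaussianProcess Y P)
    (hY_mean : ∀ t, ∫ ω, Y t ω ∂P = 0)
    (hY_spec : IsSpectralDensity Y P (fun z => g z / (|z.1| ^ (2 * d₁) * |z.2| ^ (2 * d₂))))
    {γ : ℝ} (hγ : 0 < γ) {Ω' : Type*} [MeasurableSpace Ω'] (P' : Measure Ω')
    [IsProbabilityMeasure P'] {B : ℝ≥0 × ℝ≥0 → Ω' → ℝ}
    (hB : IsFractionalBrownianSheet (d₁ + 1 / 2) (d₂ + 1 / 2) B P') :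
    ScalingLimit Y P γ ((1 + γ) / 2 + d₁ + d₂ * γ)
      (fun p ω' => kappa d₁ * kappa d₂ * B p ω') P' := by
  intro I _
  have hV := hB.isScaledSheet (kappa d₁ * kappa d₂)
  have hY : ∀ t, MemLp (Y t) 2 P := fun t => (hY_gauss.hasGaussianLaw_eval t).memLp_two
  refine tendstoInDistribution_of_tendsto_covariance (fun n => ?_) (fun n i => ?_)
    (hV.gaussian.hasGaussianLaw I) (fun i => hV.mean_zero i) fun i j => ?_
  · have h := isGaussianProcess_sum hY_gauss
      (fun p : ℝ≥0 × ℝ≥0 => Finset.Icc (1 : ℤ) ⌊(n : ℝ) * p.1⌋ ×ˢ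
        Finset.Icc (1 : ℤ) ⌊(n : ℝ) ^ γ * p.2⌋)
      (fun _ _ => (n : ℝ) ^ (-((1 + γ) / 2 + d₁ + d₂ * γ))) (fun _ t => t)
    simp_rw [← Finset.mul_sum] at h
    exact h.hasGaussianLaw I
  · rw [integral_const_mul]
    simp only [partialSum]
    rw [integral_finsetSum _ fun t _ => (hY t).integrable one_le_two]
    simp [hY_mean]
  · rw [hV.cov_eq]
    exact tendsto_covariance_partialSum hd₁ hd₁' hd₂ hd₂' hg_nonneg hg_bdd hg_lim hY hY_spec hγ i j

end Limit

end LRD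

/-! ### The main theorem -/

theorem mainTheorem4 {Ω : Type*} [MeasurableSpace Ω] (P : Measure Ω) [IsProbabilityMeasure P]
    (Y : ℤ × ℤ → Ω → ℝ) (d₁ d₂ : ℝ) (g : ℝ × ℝ → ℝ)
    (hd₁ : 0 < d₁) (hd₁' : d₁ < 1 / 2) (hd₂ : 0 < d₂) (hd₂' : d₂ < 1 / 2)
    (hg_nonneg : ∀ z ∈ LRD.freqSquare, 0 ≤ g z)
    (hg_bdd : ∃ C : ℝ, ∀ z ∈ LRD.freqSquare, g z ≤ C)
    (hg_lim : Tendsto g (𝓝[≠] (0, 0)) (𝓝 1))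
    (hY_gauss : IsGaussianProcess Y P)
    (hY_stat : LRD.IsStationaryField Y P)
    (hY_mean : ∀ t, ∫ ω, Y t ω ∂P = 0)
    (hY_spec : LRD.IsSpectralDensity Y P
      (fun z => g z / (|z.1| ^ (2 * d₁) * |z.2| ^ (2 * d₂)))) :
    -- the constant `κ(d)`: the defining integral converges and has the stated closed form
    (∀ d : ℝ, 0 < d → d < 1 / 2 →
      Integrable (LRD.kappaIntegrand d) ∧
      LRD.kappa d ^ 2 =
        Real.pi / ((d + 1 / 2) * Real.Gamma (2 * d + 1) * Real.cos (Real.pi * d))) ∧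
    -- a fractional Brownian sheet with parameters `d₁ + 1/2, d₂ + 1/2` exists
    (∃ (Ω' : Type) (_ : MeasurableSpace Ω') (P' : Measure Ω') (_ : IsProbabilityMeasure P')
      (B : ℝ≥0 × ℝ≥0 → Ω' → ℝ),
      LRD.IsFractionalBrownianSheet (d₁ + 1 / 2) (d₂ + 1 / 2) B P') ∧
    -- convergence of the normalized partial sums, for every `γ > 0`
    (∀ γ : ℝ, 0 < γ →
      ∀ {Ω' : Type*} [MeasurableSpace Ω'] (P' : Measure Ω') [IsProbabilityMeasure P']
        (B : ℝ≥0 × ℝ≥0 → Ω' → ℝ),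
        LRD.IsFractionalBrownianSheet (d₁ + 1 / 2) (d₂ + 1 / 2) B P' →
        LRD.ScalingLimit Y P γ ((1 + γ) / 2 + d₁ + d₂ * γ)
          (fun p ω' => LRD.kappa d₁ * LRD.kappa d₂ * B p ω') P') ∧
    -- long-range dependence
    LRD.TypeIILRD Y P := by
  refine ⟨fun d hd hd' => ⟨LRD.integrable_kappaIntegrand hd hd', ?_⟩,
    LRD.exists_isFractionalBrownianSheet hd₁ hd₁' hd₂ hd₂', ?_, hY_stat, fun γ hγ => ?_⟩
  · rw [LRD.kappa_sq, LRD.integral_kappaIntegrand hd hd']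
  · intro γ hγ Ω' _ P' _ B hB
    exact LRD.scalingLimit_partialSum hd₁ hd₁' hd₂ hd₂' hg_nonneg hg_bdd hg_lim hY_gauss hY_mean
      hY_spec hγ P' hB
  · obtain ⟨Ω', mΩ', P', hP', B, hB⟩ :=
      LRD.exists_isFractionalBrownianSheet hd₁ hd₁' hd₂ hd₂'
    have hk₁ := LRD.kappa_pos hd₁ hd₁'
    have hk₂ := LRD.kappa_pos hd₂ hd₂'
    refine ⟨(1 + γ) / 2 + d₁ + d₂ * γ, by positivity, Ω', mΩ', P', hP', _,
      LRD.scalingLimit_partialSum hd₁ hd₁' hd₂ hd₂' hg_nonneg hg_bdd hg_lim hY_gauss hY_mean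
        hY_spec hγ P' hB,
      (hB.isScaledSheet (LRD.kappa d₁ * LRD.kappa d₂)).hasDependentRectIncr (by positivity)
        (by linarith) (by linarith) (by linarith) (by linarith)⟩
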